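/- Write $\delta_N(S,T)$ for the area of the symmetric difference of two compact convex sets $S,T\subset[0,1]^2$. Let $L_0,L_1,\dots$ be the polynomials obtained by Gram--Schmidt orthonormalization of $1,x,x^2,\dots$ in $L^2([0,1])$, and let $\lambda_{kl}(S)=\int_S L_k(x_1)L_l(x_2)\,d(x_1,x_2)$ be the Legendre moments of $S$. For $0\le\theta_1<\dots<\theta_n<2\pi$ put $u_i=(\cos\theta_i,\sin\theta_i)$ and $P(h_1,\dots,h_n)=\bigcap_{i=1}^n\{x\in\mathbb R^2:\langle x,u_i\rangle\le h_i\}$, and let $\mathcal P(\theta_1,\dots,\theta_n)$ be the set of all nonempty $P(h_1,\dots,h_n)\subset[0,1]^2$ with $h_1,\dots,h_n\in\mathbb R$ whose support function has the value $h_i$ in the direction $u_i$ for every $i$. For $N\in\mathbb N_0$, a least squares estimator of $K$ on $\mathcal P(\theta_1,\dots,\theta_n)$ with respect to the first $(N+1)^2$ Legendre moments is any $\hat P\in\mathcal P(\theta_1,\dots,\theta_n)$ that minimizes $P\mapsto\sum_{k,l=0}^N(\lambda_{kl}(K)-\lambda_{kl}(P))^2$ over $\mathcal P(\theta_1,\dots,\theta_n)$.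 **Theorem.** There is an absolute constant $a_1>0$ such that the following holds. Let $K\subset[0,1]^2$ be a convex body (compact, convex, with nonempty interior), let $0\le\theta_1<\dots<\theta_n<2\pi$ with $0,\frac\pi2,\pi,\frac{3\pi}2\in\{\theta_1,\dots,\theta_n\}$, put $\theta_{n+1}=\theta_1$, and let $N\in\mathbb N_0$. Then every least squares estimator $\hat P$ of $K$ on $\mathcal P(\theta_1,\dots,\theta_n)$ with respect to the first $(N+1)^2$ Legendre moments satisfies $$\delta_N(\hat P,K)\le\sqrt2\,\max_{1\le i\le n}\tan\Big(\frac{\theta_{i+1}-\theta_i}2\Big)+\frac{a_1}{N+1}.$$ -/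

import Mathlib

open scoped symmDiff

namespace LegendreReconstruction

noncomputable section

/-- The Euclidean plane. -/
abbrev Plane : Type := EuclideanSpace ℝ (Fin 2)

/-- The unit square `[0,1]²`. -/
def unitSquare : Set Plane := {x | ∀ k, x k ∈ Set.Icc (0 : ℝ) 1}

/-- Gram-Schmidt orthogonalization of `1, x, x², …` with respect to the inner product
`⟨p, q⟩ = ∫₀¹ p q` (before normalization). -/
def legendreAux (n : ℕ) : Polynomial ℝ :=
  Polynomial.X ^ n - ∑ i : Fin n,
    Polynomial.C ((∫ t in (0 : ℝ)..1, t ^ n * (legendreAux i).eval t) /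
      (∫ t in (0 : ℝ)..1, (legendreAux i).eval t ^ 2)) * legendreAux i
termination_by n
decreasing_by all_goals exact i.2

/-- The shifted and normalized Legendre polynomial `L_n` on `[0,1]`, i.e. the `n`-th member of the
Gram-Schmidt orthonormalization of `1, x, x², …` in `L²([0,1])`. -/
def legendre (n : ℕ) : Polynomial ℝ :=
  Polynomial.C (Real.sqrt (∫ t in (0 : ℝ)..1, (legendreAux n).eval t ^ 2))⁻¹ * legendreAux n

/-- The Legendre moment `λ_{kl}(S) = ∫_S L_k(x₁) L_l(x₂) d(x₁,x₂)`. -/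
def legendreMoment (k l : ℕ) (S : Set Plane) : ℝ :=
  ∫ x in S, (legendre k).eval (x 0) * (legendre l).eval (x 1)

/-- The Nikodym distance: the area of the symmetric difference. -/
def nikodymDist (S T : Set Plane) : ℝ := MeasureTheory.volume.real (S ∆ T)

/-- The unit vector `(cos φ, sin φ)`. -/
def direction (φ : ℝ) : Plane := !₂[Real.cos φ, Real.sin φ]

/-- The support function `h_S(u) = sup {⟨x, u⟩ : x ∈ S}`; used for nonempty bounded sets. -/
def supportFunction (S : Set Plane) (u : Plane) : ℝ := sSup ((fun x => inner ℝ x u) '' S)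

/-- `P(h₁,…,hₙ)`, the intersection of the half-planes `⟨x, u_i⟩ ≤ h_i`, `u_i = direction (θ i)`. -/
def polygon {n : ℕ} (θ h : Fin n → ℝ) : Set Plane :=
  {x | ∀ i, inner ℝ x (direction (θ i)) ≤ h i}

/-- `(h₁,…,hₙ)` is consistent with respect to `(θ₁,…,θₙ)`: the polygon `P(h₁,…,hₙ)` has support
function value `h_i` in the direction `u_i` for every `i`. -/
def Consistent {n : ℕ} (θ h : Fin n → ℝ) : Prop :=
  (polygon θ h).Nonempty ∧ ∀ i, supportFunction (polygon θ h) (direction (θ i)) = h i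

/-- The class `𝒫(θ₁,…,θₙ)` of the polygons `P(h₁,…,hₙ) ⊆ [0,1]²` with `(h₁,…,hₙ)` consistent. -/
def polygonClass {n : ℕ} (θ : Fin n → ℝ) : Set (Set Plane) :=
  {P | P ⊆ unitSquare ∧ ∃ h : Fin n → ℝ, Consistent θ h ∧ P = polygon θ h}

/-- The least squares objective `∑_{k,l=0}^N (λ_{kl}(K) - λ_{kl}(P))²`. -/
def momentError (N : ℕ) (K P : Set Plane) : ℝ :=
  ∑ k ∈ Finset.range (N + 1), ∑ l ∈ Finset.range (N + 1),
    (legendreMoment k l K - legendreMoment k l P) ^ 2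

/-- `P` is a least squares estimator of `K` with respect to the first `(N+1)²` Legendre moments on
the class `𝒫(θ₁,…,θₙ)`. -/
def IsLeastSquaresEstimator {n : ℕ} (θ : Fin n → ℝ) (N : ℕ) (K P : Set Plane) : Prop :=
  P ∈ polygonClass θ ∧ IsMinOn (momentError N K) (polygonClass θ) P

end

end LegendreReconstruction

namespace LegendreReconstruction

open MeasureTheory

/-! The symmetric difference of two sets has area equal to the squared `L²` distance of their
indicators, and the moment error is the squared norm of the projection of `1_K - 1_P` onto the
tensor Legendre polynomials. Bessel gives `momentError ≤ nikodymDist`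
(`momentError_le_nikodymDist`). For convex sets the reverse holds up to `64 / (N + 1)`
(`nikodymDist_le_momentError_add`): every axis-parallel section is an interval, and its indicator
lies within squared distance `O(1 / (N + 1))` of the polynomials of degree at most `N`
(`exists_polynomial_step`). `integral_prod_sq_le` passes from sections to the plane.

If `Q` is the polygon of the class circumscribed about `K`, minimality of `P` gives `nikodymDist K P
≤ momentError K P + 64 / (N + 1) ≤ momentError K Q + 64 / (N + 1) ≤ nikodymDist K Q + 64 / (N + 1)`.

It remains to bound the area of `Q \ K`. Choose a contact point of `K` on each supporting line. Then
`Q \ K` is covered by triangles, each standing on a segment between consecutive contact points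
(`exists_mem_corner`). With base `d` and angle `δ` between the normals, such a triangle has area at
most `d² / 4 * tan (δ / 2)` (`corner_area_le`). Since the axis directions occur among the normals,
the contact polygon is monotone on each quadrant, and its squared sides add up to at most `4`
(`sum_sq_contact_le`). Hence the area is at most the maximal tangent; the factor `√2` is not needed.
-/

/-! ### Orthonormality and span of the Legendre polynomials. -/

lemma integral_sq_pos_of_ne_zero {p : Polynomial ℝ} (hp : p ≠ 0) :
    0 < ∫ t in (0 : ℝ)..1, p.eval t ^ 2 := by
  have hc : Continuous fun t => p.eval t ^ 2 := by fun_prop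
  obtain ⟨c, hc01, hroot⟩ : ∃ c ∈ Set.Icc (0 : ℝ) 1, p.eval c ≠ 0 := by
    by_contra! h
    exact hp (Polynomial.eq_zero_of_infinite_isRoot p
      ((Set.Icc_infinite (zero_lt_one (α := ℝ))).mono fun x hx => h x hx))
  exact intervalIntegral.integral_pos zero_lt_one hc.continuousOn (fun t _ => sq_nonneg _)
    ⟨c, hc01, by positivity⟩

lemma legendreAux_eq (n : ℕ) : legendreAux n = Polynomial.X ^ n - ∑ i : Fin n,
    Polynomial.C ((∫ t in (0 : ℝ)..1, t ^ n * (legendreAux i).eval t) /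
      (∫ t in (0 : ℝ)..1, (legendreAux i).eval t ^ 2)) * legendreAux i := by
  rw [legendreAux]

lemma legendreAux_monic_degree (n : ℕ) :
    (legendreAux n).Monic ∧ (legendreAux n).degree = n := by
  induction n using Nat.strong_induction_on with
  | _ n ih =>
    have hlt : (∑ i : Fin n,
        Polynomial.C ((∫ t in (0 : ℝ)..1, t ^ n * (legendreAux i).eval t) /
          (∫ t in (0 : ℝ)..1, (legendreAux i).eval t ^ 2)) * legendreAux i).degree
        < ((Polynomial.X : Polynomial ℝ) ^ n).degree := by
      rw [Polynomial.degree_X_pow]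
      refine Polynomial.mem_degreeLT.1 (Submodule.sum_mem _ fun i _ => ?_)
      rw [← Polynomial.smul_eq_C_mul]
      refine Submodule.smul_mem _ _ (Polynomial.mem_degreeLT.2 ?_)
      rw [(ih i i.2).2]
      exact_mod_cast i.2
    rw [legendreAux_eq]
    refine ⟨(Polynomial.monic_X_pow n).sub_of_left hlt, ?_⟩
    rw [Polynomial.degree_sub_eq_left_of_degree_lt hlt, Polynomial.degree_X_pow]

lemma legendreAux_ne_zero (n : ℕ) : legendreAux n ≠ 0 :=
  (legendreAux_monic_degree n).1.ne_zero

/-- After pairing with the `m`-th polynomial, only the `m`-th term of the Gram-Schmidt sum survives,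
and it cancels the pairing with `t ^ n`. The other terms vanish by the induction hypothesis at the
larger of the two indices. -/
lemma integral_legendreAux_mul_of_lt (n : ℕ) : ∀ m < n,
    ∫ t in (0 : ℝ)..1, (legendreAux n).eval t * (legendreAux m).eval t = 0 := by
  induction n using Nat.strong_induction_on with
  | _ n ih =>
    intro m hm
    have hval : ∀ t : ℝ, (legendreAux n).eval t * (legendreAux m).eval t =
        t ^ n * (legendreAux m).eval t - ∑ i : Fin n,
          ((∫ t in (0 : ℝ)..1, t ^ n * (legendreAux i).eval t) /
            (∫ t in (0 : ℝ)..1, (legendreAux i).eval t ^ 2)) *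
              ((legendreAux i).eval t * (legendreAux m).eval t) := by
      intro t
      rw [legendreAux_eq n, Polynomial.eval_sub, sub_mul, Polynomial.eval_finsetSum,
        Finset.sum_mul]
      simp [mul_assoc]
    simp_rw [hval]
    rw [intervalIntegral.integral_sub (Continuous.intervalIntegrable (by fun_prop) _ _)
      (Continuous.intervalIntegrable (by fun_prop) _ _),
      intervalIntegral.integral_finsetSum
        (fun i _ => Continuous.intervalIntegrable (by fun_prop) _ _)]
    rw [Finset.sum_eq_single (⟨m, hm⟩ : Fin n)]
    · rw [intervalIntegral.integral_const_mul]
      have := (integral_sq_pos_of_ne_zero (legendreAux_ne_zero m)).ne'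
      simp only [← pow_two]
      field_simp
      simp
    · intro i _ hi
      have hne : (i : ℕ) ≠ m := fun h => hi (Fin.ext h)
      rw [intervalIntegral.integral_const_mul]
      rcases lt_or_gt_of_ne hne with h | h
      · simp_rw [mul_comm ((legendreAux i).eval _) ((legendreAux m).eval _)]
        rw [ih m hm i h, mul_zero]
      · rw [ih i i.2 m h, mul_zero]
    · simp

lemma integral_legendre_mul (m n : ℕ) :
    ∫ t in (0 : ℝ)..1, (legendre m).eval t * (legendre n).eval t = if m = n then 1 else 0 := by
  simp only [legendre, Polynomial.eval_mul, Polynomial.eval_C]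
  rw [intervalIntegral.integral_congr fun t _ => mul_mul_mul_comm _ _ _ _,
    intervalIntegral.integral_const_mul]
  split_ifs with h
  · subst h
    have := integral_sq_pos_of_ne_zero (legendreAux_ne_zero m)
    rw [← mul_inv, Real.mul_self_sqrt this.le]
    simp only [← pow_two]
    exact inv_mul_cancel₀ this.ne'
  · rcases lt_or_gt_of_ne h with h | h
    · simp_rw [mul_comm ((legendreAux m).eval _)]
      rw [integral_legendreAux_mul_of_lt n m h, mul_zero]
    · rw [integral_legendreAux_mul_of_lt m n h, mul_zero]

/-- The family is monic with one member in each degree, so top coefficients can be removed one at a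
time. -/
lemma exists_eq_sum_legendreAux (N : ℕ) : ∀ p : Polynomial ℝ, p.degree < N →
    ∃ c : ℕ → ℝ, p = ∑ k ∈ Finset.range N, Polynomial.C (c k) * legendreAux k := by
  induction N with
  | zero =>
    intro p hp
    refine ⟨0, ?_⟩
    simpa [Polynomial.degree_lt_iff_coeff_zero, Polynomial.ext_iff] using hp
  | succ N ih =>
    intro p hp
    obtain ⟨hm, hd⟩ := legendreAux_monic_degree N
    obtain ⟨c, hc⟩ := ih (p - Polynomial.C (p.coeff N) * legendreAux N) (by
      rw [Polynomial.degree_lt_iff_coeff_zero]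
      intro k hk
      rcases hk.eq_or_lt with rfl | hk
      · have : (legendreAux N).coeff N = 1 := by
          have := hm.coeff_natDegree
          rwa [Polynomial.natDegree_eq_of_degree_eq_some hd] at this
        simp [this]
      · rw [Polynomial.degree_lt_iff_coeff_zero] at hp
        have : (legendreAux N).coeff k = 0 :=
          Polynomial.coeff_eq_zero_of_degree_lt (by rw [hd]; exact_mod_cast hk)
        simp [this, hp k hk])
    refine ⟨fun k => if k = N then p.coeff N else c k, ?_⟩
    rw [Finset.sum_range_succ, Finset.sum_congr rfl (g := fun k => Polynomial.C (c k) * legendreAux k)]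
    · rw [← hc]; simp
    · intro k hk
      simp [(Finset.mem_range.1 hk).ne]

lemma exists_eq_sum_legendre {N : ℕ} {p : Polynomial ℝ} (hp : p.degree < N) :
    ∃ c : ℕ → ℝ, p = ∑ k ∈ Finset.range N, Polynomial.C (c k) * legendre k := by
  obtain ⟨c, hc⟩ := exists_eq_sum_legendreAux N p hp
  refine ⟨fun k => c k * Real.sqrt (∫ t in (0 : ℝ)..1, (legendreAux k).eval t ^ 2), ?_⟩
  rw [hc]
  refine Finset.sum_congr rfl fun k _ => ?_
  have := integral_sq_pos_of_ne_zero (legendreAux_ne_zero k)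
  rw [legendre, ← mul_assoc, ← Polynomial.C_mul, mul_assoc,
    mul_inv_cancel₀ (Real.sqrt_pos.2 this).ne', mul_one]

/-! ### Polynomial approximation of a step function. -/

/-- By `sin² = (1 - cos 2·) / 2`, this is half the difference of the Fourier series of the second
Bernoulli polynomial at `0` and at `τ / π`. The term `n = 0` is `0` by the convention for division
by zero. -/
lemma hasSum_sin_sq_div_sq {τ : ℝ} (h0 : 0 ≤ τ) (h1 : τ ≤ Real.pi) :
    HasSum (fun n : ℕ => Real.sin (n * τ) ^ 2 / (n : ℝ) ^ 2) (τ * (Real.pi - τ) / 2) := by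
  have hpi := Real.pi_pos
  have h := (hasSum_one_div_nat_pow_mul_cos one_ne_zero
    (x := 0) ⟨le_rfl, zero_le_one⟩).sub (hasSum_one_div_nat_pow_mul_cos one_ne_zero
    (x := τ / Real.pi) ⟨by positivity, (div_le_one hpi).2 h1⟩)
  have h' := h.div_const 2
  have e1 : (fun n : ℕ => Real.sin (n * τ) ^ 2 / (n : ℝ) ^ 2) = fun n : ℕ =>
      (1 / (n : ℝ) ^ (2 * 1) * Real.cos (2 * Real.pi * n * 0) -
        1 / (n : ℝ) ^ (2 * 1) * Real.cos (2 * Real.pi * n * (τ / Real.pi))) / 2 := by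
    funext n
    have : 2 * Real.pi * n * (τ / Real.pi) = 2 * (n * τ) := by field_simp
    rw [this, Real.cos_two_mul, Real.sin_sq]
    simp
    ring
  have e2 : ∀ x : ℝ, ((Polynomial.bernoulli 2).map (algebraMap ℚ ℝ)).eval x =
      x ^ 2 - x + 1 / 6 := by
    intro x
    simp [Polynomial.bernoulli, Finset.sum_range_succ, bernoulli_two, bernoulli_one]
    ring
  rw [← e1] at h'
  rw [mul_one, e2, e2] at h'
  have e4 : ((-1 : ℝ) ^ (1 + 1) * (2 * Real.pi) ^ 2 / 2 / (2 : ℕ).factorial *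
      (0 ^ 2 - 0 + 1 / 6) - (-1 : ℝ) ^ (1 + 1) * (2 * Real.pi) ^ 2 / 2 / (2 : ℕ).factorial *
      ((τ / Real.pi) ^ 2 - τ / Real.pi + 1 / 6)) / 2 = τ * (Real.pi - τ) / 2 := by
    simp [Nat.factorial]
    field_simp
    ring
  rwa [e4] at h'

lemma sum_sin_sq_div_sq_tail_le {τ : ℝ} (h0 : 0 ≤ τ) (h1 : τ ≤ Real.pi) (N : ℕ) :
    τ * (Real.pi - τ) / 2 - ∑ k ∈ Finset.range (N + 1), Real.sin (k * τ) ^ 2 / (k : ℝ) ^ 2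
      ≤ 2 / ((N : ℝ) + 1) := by
  have h := hasSum_sin_sq_div_sq h0 h1
  rw [sub_le_iff_le_add]
  refine le_of_tendsto h.tendsto_sum_nat ?_
  filter_upwards [Filter.eventually_ge_atTop (N + 1)] with M hM
  rw [← Finset.sum_range_add_sum_Ico _ hM, add_comm]
  gcongr
  calc _ ≤ ∑ k ∈ Finset.Ico (N + 1) M, ((k : ℝ) ^ 2)⁻¹ := by
        refine Finset.sum_le_sum fun k _ => ?_
        rw [div_eq_mul_inv]
        exact mul_le_of_le_one_left (by positivity) (Real.sin_sq_le_one _)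
    _ = ∑ k ∈ Finset.Ioo N M, ((k : ℝ) ^ 2)⁻¹ := by
        congr 1
    _ ≤ _ := sum_Ioo_inv_sq_le N M

lemma integral_cos_nat_mul {k : ℕ} (hk : k ≠ 0) (τ : ℝ) :
    ∫ s in (0 : ℝ)..τ, Real.cos (k * s) = Real.sin (k * τ) / k := by
  have : (k : ℝ) ≠ 0 := by exact_mod_cast hk
  rw [intervalIntegral.integral_comp_mul_left _ this]
  simp [div_eq_inv_mul]

lemma integral_cos_nat_mul_mul_cos_nat_mul (k l : ℕ) :
    ∫ s in (0 : ℝ)..Real.pi, Real.cos (k * s) * Real.cos (l * s) =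
      if k = l then (if k = 0 then Real.pi else Real.pi / 2) else 0 := by
  have hint : ∀ m : ℤ, m ≠ 0 → ∫ s in (0 : ℝ)..Real.pi, Real.cos (m * s) = 0 := by
    intro m hm
    have : (m : ℝ) ≠ 0 := by exact_mod_cast hm
    rw [intervalIntegral.integral_comp_mul_left _ this]
    simp [Real.sin_int_mul_pi]
  have hval : ∀ s : ℝ, Real.cos (k * s) * Real.cos (l * s) =
      (Real.cos (((k - l : ℤ) : ℝ) * s) + Real.cos (((k + l : ℤ) : ℝ) * s)) / 2 := by
    intro s
    push_cast
    rw [sub_mul, add_mul, Real.cos_add, Real.cos_sub]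
    ring
  simp_rw [hval]
  rw [intervalIntegral.integral_div, intervalIntegral.integral_add
    (Continuous.intervalIntegrable (by fun_prop) _ _)
    (Continuous.intervalIntegrable (by fun_prop) _ _)]
  split_ifs with h h'
  · subst h; subst h'; simp
  · subst h
    rw [hint (k + k) (by omega)]
    simp
  · rw [hint (k + l) (by omega), hint (k - l) (by omega)]
    simp

/-- The coefficients of the cosine series of the indicator function of `[0, τ]` on `[0, π]`. -/
noncomputable def stepCoeff (τ : ℝ) (k : ℕ) : ℝ :=
  if k = 0 then τ / Real.pi else 2 / Real.pi * (Real.sin (k * τ) / k)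

/-- The partial sum of the cosine series of the indicator function of `[0, τ]` on `[0, π]`. -/
noncomputable def stepSum (τ : ℝ) (N : ℕ) (s : ℝ) : ℝ :=
  ∑ k ∈ Finset.range (N + 1), stepCoeff τ k * Real.cos (k * s)

lemma continuous_stepSum (τ : ℝ) (N : ℕ) : Continuous (stepSum τ N) := by
  unfold stepSum; fun_prop

lemma integral_stepSum (τ : ℝ) (N : ℕ) :
    ∫ s in (0 : ℝ)..τ, stepSum τ N s = τ ^ 2 / Real.pi +
      2 / Real.pi * ∑ k ∈ Finset.range (N + 1), Real.sin (k * τ) ^ 2 / (k : ℝ) ^ 2 := by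
  unfold stepSum
  rw [intervalIntegral.integral_finsetSum
    (fun i _ => Continuous.intervalIntegrable (by fun_prop) _ _)]
  simp_rw [intervalIntegral.integral_const_mul]
  rw [Finset.sum_range_succ', Finset.sum_range_succ', mul_add, Finset.mul_sum]
  simp only [integral_cos_nat_mul (Nat.succ_ne_zero _), stepCoeff, Nat.succ_ne_zero, if_false,
    if_true]
  simp
  rw [add_comm]
  congr 1
  · ring
  · refine Finset.sum_congr rfl fun k _ => ?_
    field_simp

/-- The value agrees with `integral_stepSum` because `stepSum` is the orthogonal projection of the
step `f`: `⟨f, Pf⟩ = ‖Pf‖²`. -/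
lemma integral_stepSum_sq (τ : ℝ) (N : ℕ) :
    ∫ s in (0 : ℝ)..Real.pi, stepSum τ N s ^ 2 = τ ^ 2 / Real.pi +
      2 / Real.pi * ∑ k ∈ Finset.range (N + 1), Real.sin (k * τ) ^ 2 / (k : ℝ) ^ 2 := by
  have hpi := Real.pi_pos
  have hval : ∀ s, stepSum τ N s ^ 2 = ∑ k ∈ Finset.range (N + 1), ∑ l ∈ Finset.range (N + 1),
      stepCoeff τ k * stepCoeff τ l * (Real.cos (k * s) * Real.cos (l * s)) := by
    intro s
    rw [stepSum, pow_two, Finset.sum_mul_sum]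
    refine Finset.sum_congr rfl fun k _ => Finset.sum_congr rfl fun l _ => by ring
  simp_rw [hval]
  rw [intervalIntegral.integral_finsetSum
    (fun i _ => Continuous.intervalIntegrable (by fun_prop) _ _)]
  have : ∀ k ∈ Finset.range (N + 1), ∫ s in (0 : ℝ)..Real.pi, ∑ l ∈ Finset.range (N + 1),
      stepCoeff τ k * stepCoeff τ l * (Real.cos (k * s) * Real.cos (l * s)) =
      stepCoeff τ k ^ 2 * (if k = 0 then Real.pi else Real.pi / 2) := by
    intro k hk
    rw [intervalIntegral.integral_finsetSum
      (fun i _ => Continuous.intervalIntegrable (by fun_prop) _ _)]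
    simp_rw [intervalIntegral.integral_const_mul, integral_cos_nat_mul_mul_cos_nat_mul]
    simp only [mul_ite, mul_zero, Finset.sum_ite_eq, hk, if_true, pow_two]
  rw [Finset.sum_congr rfl this, Finset.sum_range_succ', Finset.sum_range_succ', mul_add,
    Finset.mul_sum]
  simp [stepCoeff]
  rw [add_comm]
  congr 1
  · field_simp
  · refine Finset.sum_congr rfl fun k _ => ?_
    field_simp

lemma integral_step_sub_stepSum_sq_le {τ : ℝ} (h0 : 0 ≤ τ) (h1 : τ ≤ Real.pi) (N : ℕ) :
    (∫ s in (0 : ℝ)..τ, (1 - stepSum τ N s) ^ 2) + ∫ s in τ..Real.pi, stepSum τ N s ^ 2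
      ≤ 2 / ((N : ℝ) + 1) := by
  have hc := continuous_stepSum τ N
  have e1 : ∫ s in (0 : ℝ)..τ, (1 - stepSum τ N s) ^ 2 =
      τ - 2 * (∫ s in (0 : ℝ)..τ, stepSum τ N s) + ∫ s in (0 : ℝ)..τ, stepSum τ N s ^ 2 := by
    have : ∀ s, (1 - stepSum τ N s) ^ 2 = 1 - 2 * stepSum τ N s + stepSum τ N s ^ 2 := by
      intro s; ring
    simp_rw [this]
    rw [intervalIntegral.integral_add (Continuous.intervalIntegrable (by fun_prop) _ _)
        (Continuous.intervalIntegrable (by fun_prop) _ _),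
      intervalIntegral.integral_sub (Continuous.intervalIntegrable (by fun_prop) _ _)
        (Continuous.intervalIntegrable (by fun_prop) _ _), intervalIntegral.integral_const_mul]
    simp
  have e2 := intervalIntegral.integral_add_adjacent_intervals (μ := volume)
    (f := fun s => stepSum τ N s ^ 2) (a := 0) (b := τ) (c := Real.pi)
    (Continuous.intervalIntegrable (by fun_prop) _ _)
    (Continuous.intervalIntegrable (by fun_prop) _ _)
  rw [integral_stepSum_sq] at e2
  rw [e1, integral_stepSum, add_assoc, e2]
  have h := sum_sin_sq_div_sq_tail_le h0 h1 N
  have hpi := Real.pi_gt_three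
  set S := ∑ k ∈ Finset.range (N + 1), Real.sin (k * τ) ^ 2 / (k : ℝ) ^ 2
  -- The error is `‖f‖² - ‖Pf‖² = τ - ‖Pf‖²`, which is `2 / π` times the tail of the series above.
  calc _ = 2 / Real.pi * (τ * (Real.pi - τ) / 2 - S) := by field_simp; ring
    _ ≤ 2 / Real.pi * (2 / ((N : ℝ) + 1)) := by gcongr
    _ ≤ 1 * (2 / ((N : ℝ) + 1)) := by
      gcongr
      rw [div_le_one (by linarith)]; linarith
    _ = _ := one_mul _

/-- The indicator function of `[0, t]` is approximated by polynomials of degree at most `N` on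
`[0, 1]` with squared `L²` error of order `1 / (N + 1)`. -/
lemma exists_polynomial_step {t : ℝ} (ht : t ∈ Set.Icc (0 : ℝ) 1) (N : ℕ) :
    ∃ p : Polynomial ℝ, p.degree < (N + 1 : ℕ) ∧
      (∫ x in (0 : ℝ)..t, (1 - p.eval x) ^ 2) + ∫ x in t..1, p.eval x ^ 2
        ≤ 2 / ((N : ℝ) + 1) := by
  -- The substitution `x = (1 - cos s) / 2` maps `[0, π]` increasingly onto `[0, 1]` and `[0, τ]`
  -- onto `[0, t]`. It turns cosine sums of order `N` into polynomials of degree at most `N`,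
  -- through `T_k (cos s) = cos (k s)`.
  set τ := Real.arccos (1 - 2 * t) with hτ
  have h0 : 0 ≤ τ := Real.arccos_nonneg _
  have h1 : τ ≤ Real.pi := Real.arccos_le_pi _
  have hcos : Real.cos τ = 1 - 2 * t := Real.cos_arccos (by linarith [ht.2]) (by linarith [ht.1])
  let q : Polynomial ℝ := Polynomial.C 1 - Polynomial.C 2 * Polynomial.X
  let p : Polynomial ℝ := ∑ k ∈ Finset.range (N + 1),
    Polynomial.C (stepCoeff τ k) * (Polynomial.Chebyshev.T ℝ k).comp q
  have hp : ∀ s, p.eval ((1 - Real.cos s) / 2) = stepSum τ N s := by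
    intro s
    have hq : q.eval ((1 - Real.cos s) / 2) = Real.cos s := by simp [q]; ring
    simp only [p, Polynomial.eval_finsetSum, Polynomial.eval_mul, Polynomial.eval_C,
      Polynomial.eval_comp, hq, stepSum]
    refine Finset.sum_congr rfl fun k _ => ?_
    rw [Polynomial.Chebyshev.T_real_cos]
    simp
  refine ⟨p, ?_, ?_⟩
  · refine Polynomial.mem_degreeLT.1 (Submodule.sum_mem _ fun k hk => ?_)
    rw [← Polynomial.smul_eq_C_mul]
    refine Submodule.smul_mem _ _ (Polynomial.mem_degreeLT.2 ?_)
    refine Polynomial.degree_le_natDegree.trans_lt ?_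
    have hq : q.natDegree ≤ 1 := by
      unfold q; compute_degree
    have hT : (Polynomial.Chebyshev.T ℝ (k : ℤ)).natDegree = k := by simp
    have hk' := Finset.mem_range.1 hk
    have : ((Polynomial.Chebyshev.T ℝ (k : ℤ)).comp q).natDegree < N + 1 := by
      rw [Polynomial.natDegree_comp, hT]
      nlinarith
    exact_mod_cast this
  · have hsub : ∀ (g : ℝ → ℝ) (a b : ℝ), Continuous g →
        ∫ s in a..b, g ((1 - Real.cos s) / 2) * (Real.sin s / 2) =
          ∫ x in (1 - Real.cos a) / 2..(1 - Real.cos b) / 2, g x := by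
      intro g a b hg
      refine intervalIntegral.integral_comp_mul_deriv (f := fun s => (1 - Real.cos s) / 2)
        (fun s _ => ?_) (by fun_prop) hg
      simpa using ((Real.hasDerivAt_cos s).const_sub 1).div_const 2
    have hc := continuous_stepSum τ N
    -- The Jacobian `sin s / 2` is at most `1`, so the unweighted error on `[0, π]` dominates the
    -- error on `[0, 1]`.
    have hle : ∀ (g : ℝ → ℝ) (a b : ℝ), Continuous g → (∀ s, 0 ≤ g s) → a ≤ b →
        ∫ s in a..b, g s * (Real.sin s / 2) ≤ ∫ s in a..b, g s := by
      intro g a b hg hpos hab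
      refine intervalIntegral.integral_mono_on hab (Continuous.intervalIntegrable (by fun_prop) _ _)
        (Continuous.intervalIntegrable (by fun_prop) _ _) fun s _ => ?_
      exact mul_le_of_le_one_right (hpos s) (by linarith [Real.sin_le_one s])
    have e1 := hsub (fun x => (1 - p.eval x) ^ 2) 0 τ (by fun_prop)
    have e2 := hsub (fun x => p.eval x ^ 2) τ Real.pi (by fun_prop)
    simp only [hp, hcos, Real.cos_zero, Real.cos_pi] at e1 e2
    norm_num at e1 e2
    rw [← e1, ← e2]
    refine le_trans (add_le_add (hle _ _ _ (by fun_prop) (fun s => sq_nonneg _) h0)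
      (hle _ _ _ (by fun_prop) (fun s => sq_nonneg _) h1)) ?_
    exact integral_step_sub_stepSum_sq_le h0 h1 N

/-! ### Bessel's inequality and tensor products of orthonormal families. -/

section Tensor

variable {X Y : Type*} [MeasurableSpace X] [MeasurableSpace Y]

/-- A real function is measurable and bounded. -/
structure BddMeasurable (f : X → ℝ) : Prop where
  measurable : Measurable f
  bdd : ∃ C, ∀ x, |f x| ≤ C

namespace BddMeasurable

lemma const (c : ℝ) : BddMeasurable fun _ : X => c := ⟨measurable_const, |c|, fun _ => le_rfl⟩

lemma add {f g : X → ℝ} (hf : BddMeasurable f) (hg : BddMeasurable g) :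
    BddMeasurable fun x => f x + g x := by
  obtain ⟨C, hC⟩ := hf.bdd
  obtain ⟨D, hD⟩ := hg.bdd
  exact ⟨hf.measurable.add hg.measurable, C + D,
    fun x => (abs_add_le _ _).trans (add_le_add (hC x) (hD x))⟩

lemma mul {f g : X → ℝ} (hf : BddMeasurable f) (hg : BddMeasurable g) :
    BddMeasurable fun x => f x * g x := by
  obtain ⟨C, hC⟩ := hf.bdd
  obtain ⟨D, hD⟩ := hg.bdd
  refine ⟨hf.measurable.mul hg.measurable, C * D, fun x => ?_⟩
  rw [abs_mul]
  exact mul_le_mul (hC x) (hD x) (abs_nonneg _) ((abs_nonneg _).trans (hC x))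

lemma sub {f g : X → ℝ} (hf : BddMeasurable f) (hg : BddMeasurable g) :
    BddMeasurable fun x => f x - g x := by
  simpa [sub_eq_add_neg] using hf.add ((const (-1)).mul hg)

lemma sq {f : X → ℝ} (hf : BddMeasurable f) : BddMeasurable fun x => f x ^ 2 := by
  simpa [pow_two] using hf.mul hf

lemma sum {ι : Type*} {s : Finset ι} {f : ι → X → ℝ} (hf : ∀ i, BddMeasurable (f i)) :
    BddMeasurable fun x => ∑ i ∈ s, f i x := by
  classical
  induction s using Finset.induction_on with
  | empty => simpa using const 0
  | insert i s hi ih =>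
    simp only [Finset.sum_insert hi]
    exact (hf i).add ih

lemma comp {f : X → ℝ} (hf : BddMeasurable f) {g : Y → X} (hg : Measurable g) :
    BddMeasurable fun y => f (g y) := by
  obtain ⟨C, hC⟩ := hf.bdd
  exact ⟨hf.measurable.comp hg, C, fun y => hC _⟩

lemma integrable {f : X → ℝ} (hf : BddMeasurable f) (μ : Measure X) [IsFiniteMeasure μ] :
    Integrable f μ := by
  obtain ⟨C, hC⟩ := hf.bdd
  exact Integrable.of_bound hf.measurable.aestronglyMeasurable C (ae_of_all _ hC)

lemma integral_left {f : X × Y → ℝ} (hf : BddMeasurable f) (μ : Measure X) [IsFiniteMeasure μ] :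
    BddMeasurable fun y => ∫ x, f (x, y) ∂μ := by
  obtain ⟨C, hC⟩ := hf.bdd
  refine ⟨hf.measurable.stronglyMeasurable.integral_prod_left'.measurable, C * μ.real Set.univ,
    fun y => ?_⟩
  exact norm_integral_le_of_norm_le_const (f := fun x => f (x, y)) (C := C)
    (ae_of_all _ fun x => hC (x, y))

lemma integral_right {f : X × Y → ℝ} (hf : BddMeasurable f) (ν : Measure Y) [IsFiniteMeasure ν] :
    BddMeasurable fun x => ∫ y, f (x, y) ∂ν :=
  (hf.comp measurable_swap).integral_left ν

end BddMeasurable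

/-- The squared `L²` distance of `f` from the span of the orthonormal family `(e k)`, `k ∈ s`. -/
noncomputable def projErr {ι : Type*} (μ : Measure X) (e : ι → X → ℝ) (s : Finset ι)
    (f : X → ℝ) : ℝ :=
  ∫ x, f x ^ 2 ∂μ - ∑ k ∈ s, (∫ x, f x * e k x ∂μ) ^ 2

/-- A family of bounded measurable functions that is orthonormal in `L²(μ)`. -/
structure BddOrthonormal {ι : Type*} [DecidableEq ι] (μ : Measure X) (e : ι → X → ℝ) : Prop where
  bddMeasurable : ∀ k, BddMeasurable (e k)
  integral_mul : ∀ k l, ∫ x, e k x * e l x ∂μ = if k = l then 1 else 0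

section Bessel

variable {ι : Type*} [DecidableEq ι] {μ : Measure X} [IsFiniteMeasure μ] {e : ι → X → ℝ}

/-- Pythagoras: expand the square and complete it in each coefficient. Best approximation, the
residual formula and Bessel's inequality all follow by choosing `c`. -/
lemma BddOrthonormal.integral_sub_sum_sq (he : BddOrthonormal μ e) {f : X → ℝ}
    (hf : BddMeasurable f) (s : Finset ι) (c : ι → ℝ) :
    ∫ x, (f x - ∑ k ∈ s, c k * e k x) ^ 2 ∂μ =
      projErr μ e s f + ∑ k ∈ s, (c k - ∫ x, f x * e k x ∂μ) ^ 2 := by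
  have hem := he.bddMeasurable
  have hval : ∀ x, (f x - ∑ k ∈ s, c k * e k x) ^ 2 =
      f x ^ 2 - (∑ k ∈ s, 2 * c k * (f x * e k x)) +
        ∑ k ∈ s, ∑ l ∈ s, c k * c l * (e k x * e l x) := by
    intro x
    have h1 : ∑ k ∈ s, ∑ l ∈ s, c k * c l * (e k x * e l x) = (∑ k ∈ s, c k * e k x) ^ 2 := by
      rw [pow_two, Finset.sum_mul_sum]
      exact Finset.sum_congr rfl fun k _ => Finset.sum_congr rfl fun l _ => by ring
    have h2 : ∑ k ∈ s, 2 * c k * (f x * e k x) = 2 * f x * ∑ k ∈ s, c k * e k x := by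
      rw [Finset.mul_sum]
      exact Finset.sum_congr rfl fun k _ => by ring
    rw [h1, h2]; ring
  have b1 : ∀ k, BddMeasurable fun x => 2 * c k * (f x * e k x) :=
    fun k => (BddMeasurable.const _).mul (hf.mul (hem k))
  have b2 : ∀ k l, BddMeasurable fun x => c k * c l * (e k x * e l x) :=
    fun k l => (BddMeasurable.const _).mul ((hem k).mul (hem l))
  simp_rw [hval]
  rw [integral_add ((hf.sq.sub (BddMeasurable.sum b1)).integrable μ)
      ((BddMeasurable.sum fun k => BddMeasurable.sum (b2 k)).integrable μ),
    integral_sub (hf.sq.integrable μ) ((BddMeasurable.sum b1).integrable μ),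
    integral_finsetSum _ fun k _ => (b1 k).integrable μ,
    integral_finsetSum _ fun k _ => (BddMeasurable.sum (b2 k)).integrable μ]
  have h3 : ∀ k ∈ s, ∫ x, ∑ l ∈ s, c k * c l * (e k x * e l x) ∂μ = c k ^ 2 := by
    intro k hk
    rw [integral_finsetSum _ fun l _ => (b2 k l).integrable μ]
    simp_rw [integral_const_mul, he.integral_mul]
    simp [hk, pow_two]
  rw [Finset.sum_congr rfl h3]
  simp_rw [integral_const_mul, projErr, sub_sq, Finset.sum_add_distrib, Finset.sum_sub_distrib]
  ring

lemma BddOrthonormal.projErr_le (he : BddOrthonormal μ e) {f : X → ℝ}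
    (hf : BddMeasurable f) (s : Finset ι) (c : ι → ℝ) :
    projErr μ e s f ≤ ∫ x, (f x - ∑ k ∈ s, c k * e k x) ^ 2 ∂μ := by
  rw [he.integral_sub_sum_sq hf]
  exact le_add_of_nonneg_right (Finset.sum_nonneg fun k _ => sq_nonneg _)

lemma BddOrthonormal.projErr_eq (he : BddOrthonormal μ e) {f : X → ℝ}
    (hf : BddMeasurable f) (s : Finset ι) :
    ∫ x, (f x - ∑ k ∈ s, (∫ x, f x * e k x ∂μ) * e k x) ^ 2 ∂μ = projErr μ e s f := by
  rw [he.integral_sub_sum_sq hf]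
  simp

lemma BddOrthonormal.projErr_nonneg (he : BddOrthonormal μ e) {f : X → ℝ}
    (hf : BddMeasurable f) (s : Finset ι) : 0 ≤ projErr μ e s f := by
  rw [← he.projErr_eq hf]
  exact integral_nonneg fun x => sq_nonneg _

lemma BddOrthonormal.prod (he : BddOrthonormal μ e) :
    BddOrthonormal (μ.prod μ) fun (k : ι × ι) (z : X × X) => e k.1 z.1 * e k.2 z.2 where
  bddMeasurable k := ((he.bddMeasurable k.1).comp measurable_fst).mul
    ((he.bddMeasurable k.2).comp measurable_snd)
  integral_mul k l := by
    simp_rw [mul_mul_mul_comm]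
    rw [integral_prod_mul (μ := μ) (ν := μ) (fun x => e k.1 x * e l.1 x)
      (fun y => e k.2 y * e l.2 y), he.integral_mul, he.integral_mul]
    split_ifs <;> simp_all [Prod.ext_iff]

lemma integral_prod_sub_sum_le [IsProbabilityMeasure μ] (he : BddOrthonormal μ e)
    (s : Finset ι) {F : X × X → ℝ} (hF : BddMeasurable F) {E : ℝ}
    (hE : ∀ x, projErr μ e s (fun y => F (x, y)) ≤ E) :
    ∫ z, F z ^ 2 ∂(μ.prod μ) - ∑ l ∈ s, ∫ x, (∫ y, F (x, y) * e l y ∂μ) ^ 2 ∂μ ≤ E := by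
  have hb : ∀ l, BddMeasurable fun x => ∫ y, F (x, y) * e l y ∂μ := fun l =>
    BddMeasurable.integral_right (f := fun z => F z * e l z.2)
      (hF.mul ((he.bddMeasurable l).comp measurable_snd)) μ
  rw [integral_prod _ (hF.sq.integrable _), ← integral_finsetSum _
    fun l _ => (hb l).sq.integrable μ, ← integral_sub ((hF.sq.integral_right μ).integrable μ)
    ((BddMeasurable.sum fun l => (hb l).sq).integrable μ)]
  refine (integral_mono (((hF.sq.integral_right μ).sub
    (BddMeasurable.sum fun l => (hb l).sq)).integrable μ) (integrable_const E) hE).trans ?_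
  simp

/-- If all one-dimensional sections of `F` are within squared distance `E` of the span of a finite
orthonormal family, then `F` is within squared distance `2 * E` of the span of its tensor square. -/
lemma integral_prod_sq_le [IsProbabilityMeasure μ] (he : BddOrthonormal μ e)
    (s : Finset ι) {F : X × X → ℝ} (hF : BddMeasurable F) {E : ℝ}
    (hE₁ : ∀ y, projErr μ e s (fun x => F (x, y)) ≤ E)
    (hE₂ : ∀ x, projErr μ e s (fun y => F (x, y)) ≤ E) :
    ∫ z, F z ^ 2 ∂(μ.prod μ) ≤
      ∑ k ∈ s, ∑ l ∈ s, (∫ z, F z * (e k z.1 * e l z.2) ∂(μ.prod μ)) ^ 2 + 2 * E := by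
  have hem := he.bddMeasurable
  have hem1 : ∀ k, BddMeasurable fun z : X × X => e k z.1 := fun k => (hem k).comp measurable_fst
  have hem2 : ∀ k, BddMeasurable fun z : X × X => e k z.2 := fun k => (hem k).comp measurable_snd
  -- With `P₁`, `P₂` the projections in the two variables, the argument is `I - P₁P₂ = (I - P₂) + (I
  -- - P₁)P₂` in its symmetric form: `a` and `b` are the coefficients of `P₁F` and `P₂F`, and `Λ`
  -- those of `P₁P₂F`.
  set a : ι → X → ℝ := fun k y => ∫ x, F (x, y) * e k x ∂μ with ha
  set b : ι → X → ℝ := fun l x => ∫ y, F (x, y) * e l y ∂μ with hb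
  have ham : ∀ k, BddMeasurable (a k) := fun k =>
    BddMeasurable.integral_left (f := fun z => F z * e k z.1) (hF.mul (hem1 k)) μ
  have hbm : ∀ k, BddMeasurable (b k) := fun k =>
    BddMeasurable.integral_right (f := fun z => F z * e k z.2) (hF.mul (hem2 k)) μ
  set Λ : ι → ι → ℝ := fun k l => ∫ z, F z * (e k z.1 * e l z.2) ∂(μ.prod μ) with hΛ
  have hint : ∀ k l, BddMeasurable fun z : X × X => F z * (e k z.1 * e l z.2) :=
    fun k l => hF.mul ((hem1 k).mul (hem2 l))
  have hΛa : ∀ k l, ∫ y, a k y * e l y ∂μ = Λ k l := by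
    intro k l
    simp only [hΛ]
    rw [integral_prod_symm _ ((hint k l).integrable _)]
    refine integral_congr_ae (ae_of_all _ fun y => ?_)
    simp only [ha, ← mul_assoc]
    rw [integral_mul_const]
  have hΛb : ∀ k l, ∫ x, b l x * e k x ∂μ = Λ k l := by
    intro k l
    simp only [hΛ]
    rw [integral_prod _ ((hint k l).integrable _)]
    refine integral_congr_ae (ae_of_all _ fun x => ?_)
    simp only [hb]
    rw [← integral_mul_const]
    exact integral_congr_ae (ae_of_all _ fun y => by ring)
  have h1 : ∫ z, F z ^ 2 ∂(μ.prod μ) - ∑ k ∈ s, ∫ y, a k y ^ 2 ∂μ ≤ E := by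
    have := integral_prod_sub_sum_le he s (hF.comp measurable_swap) hE₁
    rw [integral_prod_swap (fun z => F z ^ 2)] at this
    exact this
  have h2 : ∫ z, F z ^ 2 ∂(μ.prod μ) - ∑ l ∈ s, ∫ x, b l x ^ 2 ∂μ ≤ E :=
    integral_prod_sub_sum_le he s hF hE₂
  set R : X × X → ℝ := fun z => F z - ∑ l ∈ s, b l z.1 * e l z.2 with hR
  have hbm1 : ∀ k, BddMeasurable fun z : X × X => b k z.1 := fun k => (hbm k).comp measurable_fst
  have hRm : BddMeasurable R := hF.sub (BddMeasurable.sum fun l => (hbm1 l).mul (hem2 l))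
  have hRk : ∀ k y, ∫ x, R (x, y) * e k x ∂μ = a k y - ∑ l ∈ s, Λ k l * e l y := by
    intro k y
    have hslice : Measurable fun x : X => (x, y) := measurable_prodMk_right
    have hbk : ∀ l, BddMeasurable fun x => b l x * e k x * e l y :=
      fun l => ((hbm l).mul (hem k)).mul (BddMeasurable.const _)
    have : ∀ x, R (x, y) * e k x = F (x, y) * e k x - ∑ l ∈ s, b l x * e k x * e l y := by
      intro x
      simp only [hR, sub_mul, Finset.sum_mul]
      congr 1
      exact Finset.sum_congr rfl fun l _ => by ring
    simp_rw [this]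
    rw [integral_sub (((hF.comp hslice).mul (hem k)).integrable μ)
      ((BddMeasurable.sum hbk).integrable μ), integral_finsetSum _ fun l _ => (hbk l).integrable μ]
    simp_rw [integral_mul_const, hΛb]
    rfl
  -- Bessel in the first variable for the residual `R = F - P₂F`: `‖P₁R‖² ≤ ‖R‖²`. By `h4`, `h5` and
  -- `h2` this becomes `‖P₁F‖² - ‖P₁P₂F‖² ≤ E`, and adding `h1` yields `2 * E`.
  have h3 : ∑ k ∈ s, ∫ y, (a k y - ∑ l ∈ s, Λ k l * e l y) ^ 2 ∂μ ≤
      ∫ z, R z ^ 2 ∂(μ.prod μ) := by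
    have hm : ∀ k, BddMeasurable fun y => (a k y - ∑ l ∈ s, Λ k l * e l y) ^ 2 := fun k =>
      ((ham k).sub (BddMeasurable.sum fun l => (BddMeasurable.const _).mul (hem l))).sq
    rw [← integral_finsetSum _ fun k _ => (hm k).integrable μ,
      integral_prod_symm _ (hRm.sq.integrable _)]
    refine integral_mono ((BddMeasurable.sum hm).integrable μ)
      ((hRm.sq.integral_left μ).integrable μ) fun y => ?_
    have := he.projErr_nonneg (hRm.comp (measurable_prodMk_right (y := y))) s
    simp only [projErr, hRk] at this
    linarith
  have h4 : ∀ k, ∫ y, (a k y - ∑ l ∈ s, Λ k l * e l y) ^ 2 ∂μ =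
      ∫ y, a k y ^ 2 ∂μ - ∑ l ∈ s, Λ k l ^ 2 := by
    intro k
    have := he.projErr_eq (ham k) s
    simpa only [projErr, hΛa] using this
  have h5 : ∫ z, R z ^ 2 ∂(μ.prod μ) =
      ∫ z, F z ^ 2 ∂(μ.prod μ) - ∑ l ∈ s, ∫ x, b l x ^ 2 ∂μ := by
    rw [integral_prod _ (hRm.sq.integrable _), integral_prod _ (hF.sq.integrable _),
      ← integral_finsetSum _ fun l _ => (hbm l).sq.integrable μ,
      ← integral_sub ((hF.sq.integral_right μ).integrable μ)
        ((BddMeasurable.sum fun l => (hbm l).sq).integrable μ)]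
    refine integral_congr_ae (ae_of_all _ fun x => ?_)
    exact he.projErr_eq (hF.comp (measurable_prodMk_left (x := x))) s
  simp_rw [h4, Finset.sum_sub_distrib] at h3
  linarith

lemma sum_sq_integral_prod_le (he : BddOrthonormal μ e)
    (s : Finset ι) {F : X × X → ℝ} (hF : BddMeasurable F) :
    ∑ k ∈ s, ∑ l ∈ s, (∫ z, F z * (e k z.1 * e l z.2) ∂(μ.prod μ)) ^ 2 ≤
      ∫ z, F z ^ 2 ∂(μ.prod μ) := by
  have := he.prod.projErr_nonneg hF (s ×ˢ s)
  rw [projErr, Finset.sum_product] at this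
  linarith

end Bessel

end Tensor

/-! ### Legendre approximation of interval indicators. -/

/-- Lebesgue measure on `[0, 1]`. -/
noncomputable abbrev unitMeasure : Measure ℝ := volume.restrict (Set.Icc (0 : ℝ) 1)

instance : IsProbabilityMeasure unitMeasure := ⟨by simp [unitMeasure]⟩

/-- The normalized Legendre polynomial cut off outside of `[0, 1]`. -/
noncomputable def legendreFun (k : ℕ) : ℝ → ℝ :=
  (Set.Icc (0 : ℝ) 1).indicator fun x => (legendre k).eval x

lemma integral_unitMeasure (f : ℝ → ℝ) : ∫ x, f x ∂unitMeasure = ∫ x in (0 : ℝ)..1, f x := by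
  rw [intervalIntegral.integral_of_le zero_le_one, integral_Icc_eq_integral_Ioc]

lemma bddMeasurable_indicator_polynomial (p : Polynomial ℝ) :
    BddMeasurable ((Set.Icc (0 : ℝ) 1).indicator fun x => p.eval x) := by
  refine ⟨p.continuous.measurable.indicator measurableSet_Icc, ?_⟩
  obtain ⟨C, hC⟩ := isCompact_Icc.exists_bound_of_continuousOn
    (p.continuous.continuousOn (s := Set.Icc (0 : ℝ) 1))
  refine ⟨max C 0, fun x => ?_⟩
  by_cases hx : x ∈ Set.Icc (0 : ℝ) 1
  · rw [Set.indicator_of_mem hx]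
    exact (hC x hx).trans (le_max_left _ _)
  · rw [Set.indicator_of_notMem hx]
    simp

lemma bddOrthonormal_legendreFun : BddOrthonormal unitMeasure legendreFun where
  bddMeasurable k := bddMeasurable_indicator_polynomial _
  integral_mul k l := by
    rw [← integral_legendre_mul k l, ← integral_unitMeasure]
    refine setIntegral_congr_fun measurableSet_Icc fun x hx => ?_
    simp only [legendreFun, Set.indicator_of_mem hx]

lemma projErr_legendreFun_le {f : ℝ → ℝ} (hf : BddMeasurable f) {N : ℕ} {p : Polynomial ℝ}
    (hp : p.degree < (N + 1 : ℕ)) :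
    projErr unitMeasure legendreFun (Finset.range (N + 1)) f ≤
      ∫ x, (f x - p.eval x) ^ 2 ∂unitMeasure := by
  obtain ⟨c, rfl⟩ := exists_eq_sum_legendre hp
  refine (bddOrthonormal_legendreFun.projErr_le hf _ c).trans (le_of_eq ?_)
  refine setIntegral_congr_fun measurableSet_Icc fun x hx => ?_
  simp only [legendreFun, Set.indicator_of_mem hx, Polynomial.eval_finsetSum, Polynomial.eval_mul,
    Polynomial.eval_C]

lemma exists_polynomial_indicator_Iic {t : ℝ} (ht : t ∈ Set.Icc (0 : ℝ) 1) (N : ℕ) :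
    ∃ p : Polynomial ℝ, p.degree < (N + 1 : ℕ) ∧
      ∫ x, ((Set.Iic t).indicator 1 x - p.eval x) ^ 2 ∂unitMeasure ≤ 2 / ((N : ℝ) + 1) := by
  obtain ⟨p, hp, h⟩ := exists_polynomial_step ht N
  refine ⟨p, hp, le_trans (le_of_eq ?_) h⟩
  have e1 : Set.EqOn (fun x => ((Set.Iic t).indicator 1 x - p.eval x) ^ 2)
      (fun x => (1 - p.eval x) ^ 2) (Set.Ioc 0 t) := fun x hx => by
    simp [Set.indicator_of_mem (show x ∈ Set.Iic t from hx.2)]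
  have e2 : Set.EqOn (fun x => ((Set.Iic t).indicator 1 x - p.eval x) ^ 2)
      (fun x => p.eval x ^ 2) (Set.Ioc t 1) := fun x hx => by
    simp [Set.indicator_of_notMem (show x ∉ Set.Iic t from not_le.2 hx.1)]
  have i1 : IntervalIntegrable (fun x => ((Set.Iic t).indicator 1 x - p.eval x) ^ 2) volume 0 t := by
    rw [intervalIntegrable_iff_integrableOn_Ioc_of_le ht.1, integrableOn_congr_fun e1
      measurableSet_Ioc, ← intervalIntegrable_iff_integrableOn_Ioc_of_le ht.1]
    exact Continuous.intervalIntegrable (by fun_prop) _ _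
  have i2 : IntervalIntegrable (fun x => ((Set.Iic t).indicator 1 x - p.eval x) ^ 2) volume t 1 := by
    rw [intervalIntegrable_iff_integrableOn_Ioc_of_le ht.2, integrableOn_congr_fun e2
      measurableSet_Ioc, ← intervalIntegrable_iff_integrableOn_Ioc_of_le ht.2]
    exact Continuous.intervalIntegrable (by fun_prop) _ _
  rw [integral_unitMeasure, ← intervalIntegral.integral_add_adjacent_intervals i1 i2]
  congr 1
  · rw [intervalIntegral.integral_of_le ht.1, intervalIntegral.integral_of_le ht.1]
    exact setIntegral_congr_fun measurableSet_Ioc e1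
  · rw [intervalIntegral.integral_of_le ht.2, intervalIntegral.integral_of_le ht.2]
    exact setIntegral_congr_fun measurableSet_Ioc e2

lemma bddMeasurable_indicator_one {X : Type*} [MeasurableSpace X] {S : Set X}
    (hS : MeasurableSet S) : BddMeasurable (S.indicator (1 : X → ℝ)) := by
  refine ⟨measurable_one.indicator hS, 1, fun x => ?_⟩
  by_cases h : x ∈ S <;> simp [h]

lemma integral_sub_sq_sub_polynomial_le {f g : ℝ → ℝ} (hf : BddMeasurable f)
    (hg : BddMeasurable g) (p q : Polynomial ℝ) :
    ∫ x, (f x - g x - (p - q).eval x) ^ 2 ∂unitMeasure ≤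
      2 * (∫ x, (f x - p.eval x) ^ 2 ∂unitMeasure + ∫ x, (g x - q.eval x) ^ 2 ∂unitMeasure) := by
  -- Polynomials are bounded only on `[0, 1]`, so integrability goes through the cut-off polynomial.
  have key : ∀ (f : ℝ → ℝ) (p : Polynomial ℝ), BddMeasurable f →
      Integrable (fun x => (f x - p.eval x) ^ 2) unitMeasure := by
    intro f p hf
    refine (integrable_congr ?_).1 ((hf.sub (bddMeasurable_indicator_polynomial p)).sq.integrable _)
    refine (ae_restrict_iff' measurableSet_Icc).2 (ae_of_all _ fun x hx => ?_)
    simp only [Set.indicator_of_mem hx]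
  rw [← integral_add (key f p hf) (key g q hg), ← integral_const_mul]
  refine integral_mono (key _ _ (hf.sub hg)) (((key f p hf).add (key g q hg)).const_mul 2)
    fun x => ?_
  simp only [Polynomial.eval_sub]
  nlinarith [sq_nonneg ((f x - p.eval x) + (g x - q.eval x))]

/-- A nonempty `S` is an interval `[a, b]`, whose indicator is the difference of the steps at `b`
and `a` except at the single point `a`. The constant is `8 = 2 * (2 + 2)`, from `(u - v)² ≤ 2u² +
2v²`. -/
lemma exists_polynomial_indicator {S : Set ℝ} (hc : IsCompact S) (hconv : Convex ℝ S)
    (hS : S ⊆ Set.Icc 0 1) (N : ℕ) :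
    ∃ p : Polynomial ℝ, p.degree < (N + 1 : ℕ) ∧
      ∫ x, (S.indicator 1 x - p.eval x) ^ 2 ∂unitMeasure ≤ 8 / ((N : ℝ) + 1) := by
  rcases S.eq_empty_or_nonempty with rfl | hne
  · exact ⟨0, by simp, by simp; positivity⟩
  have hIcc := eq_Icc_of_connected_compact ⟨hne, hconv.isPreconnected⟩ hc
  have ha := hS (hc.sInf_mem hne)
  have hb := hS (hc.sSup_mem hne)
  have hab : sInf S ≤ sSup S := csInf_le_csSup hne hc.bddBelow hc.bddAbove
  set a := sInf S
  set b := sSup S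
  obtain ⟨p, hp, hp'⟩ := exists_polynomial_indicator_Iic hb N
  obtain ⟨q, hq, hq'⟩ := exists_polynomial_indicator_Iic ha N
  refine ⟨p - q, (Polynomial.degree_sub_le _ _).trans_lt (max_lt hp hq), ?_⟩
  have h := integral_sub_sq_sub_polynomial_le (bddMeasurable_indicator_one (measurableSet_Iic (a := b)))
    (bddMeasurable_indicator_one (measurableSet_Iic (a := a))) p q
  have h8 : 8 / ((N : ℝ) + 1) = 2 * (2 / ((N : ℝ) + 1) + 2 / ((N : ℝ) + 1)) := by ring
  rw [h8]
  refine le_trans (le_of_eq ?_) (h.trans (by gcongr))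
  refine integral_congr_ae (ae_restrict_of_ae ?_)
  filter_upwards [Measure.ae_ne volume a] with x hx
  rw [hIcc]
  congr 2
  simp only [Set.indicator_apply, Set.mem_Icc, Set.mem_Iic, Pi.one_apply]
  rcases lt_or_gt_of_ne hx with h | h
  · simp [h.le, h.not_ge, (h.le.trans hab)]
  · simp [h.le, h.not_ge]

lemma projErr_indicator_sub_le {S T : Set ℝ} (hS : IsCompact S) (hS' : Convex ℝ S)
    (hS₁ : S ⊆ Set.Icc 0 1) (hT : IsCompact T) (hT' : Convex ℝ T) (hT₁ : T ⊆ Set.Icc 0 1) (N : ℕ) :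
    projErr unitMeasure legendreFun (Finset.range (N + 1))
      (fun x => S.indicator 1 x - T.indicator 1 x) ≤ 32 / ((N : ℝ) + 1) := by
  obtain ⟨p, hp, hp'⟩ := exists_polynomial_indicator hS hS' hS₁ N
  obtain ⟨q, hq, hq'⟩ := exists_polynomial_indicator hT hT' hT₁ N
  have bS := bddMeasurable_indicator_one hS.measurableSet
  have bT := bddMeasurable_indicator_one hT.measurableSet
  refine (projErr_legendreFun_le (bS.sub bT)
    ((Polynomial.degree_sub_le p q).trans_lt (max_lt hp hq))).trans ?_
  have h32 : 32 / ((N : ℝ) + 1) = 2 * (8 / ((N : ℝ) + 1) + 8 / ((N : ℝ) + 1)) := by ring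
  rw [h32]
  exact (integral_sub_sq_sub_polynomial_le bS bT p q).trans (by gcongr)

/-! ### Moments and areas of planar sets. -/

/-- The coordinates on the Euclidean plane. -/
noncomputable def planeEquiv : Plane ≃ᵐ ℝ × ℝ :=
  (MeasurableEquiv.toLp 2 (Fin 2 → ℝ)).symm.trans MeasurableEquiv.finTwoArrow

@[simp] lemma planeEquiv_apply (x : Plane) : planeEquiv x = (x 0, x 1) := rfl

@[simp] lemma planeEquiv_symm_apply_zero (z : ℝ × ℝ) : planeEquiv.symm z 0 = z.1 := rfl

@[simp] lemma planeEquiv_symm_apply_one (z : ℝ × ℝ) : planeEquiv.symm z 1 = z.2 := rfl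

lemma measurePreserving_planeEquiv : MeasurePreserving planeEquiv :=
  (volume_preserving_finTwoArrow ℝ).comp
    (EuclideanSpace.volume_preserving_symm_measurableEquiv_toLp (Fin 2))

/-- The indicator function of a planar set, in coordinates. -/
noncomputable def planeIndicator (S : Set Plane) : ℝ × ℝ → ℝ :=
  (planeEquiv.symm ⁻¹' S).indicator 1

lemma bddMeasurable_planeIndicator {S : Set Plane} (hS : MeasurableSet S) :
    BddMeasurable (planeIndicator S) :=
  bddMeasurable_indicator_one (planeEquiv.symm.measurable hS)

lemma planeIndicator_eq_zero {S : Set Plane} (hS : S ⊆ unitSquare) {z : ℝ × ℝ}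
    (hz : z ∉ Set.Icc (0 : ℝ) 1 ×ˢ Set.Icc (0 : ℝ) 1) : planeIndicator S z = 0 := by
  refine Set.indicator_of_notMem (fun h => hz ?_) _
  have := hS h
  exact ⟨by simpa using this 0, by simpa using this 1⟩

lemma integral_prod_unitMeasure {f : ℝ × ℝ → ℝ}
    (hf : ∀ z ∉ Set.Icc (0 : ℝ) 1 ×ˢ Set.Icc (0 : ℝ) 1, f z = 0) :
    ∫ z, f z ∂(unitMeasure.prod unitMeasure) = ∫ x : Plane, f (x 0, x 1) := by
  rw [unitMeasure, Measure.prod_restrict, setIntegral_eq_integral_of_forall_compl_eq_zero hf]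
  exact (measurePreserving_planeEquiv.integral_comp planeEquiv.measurableEmbedding f).symm

lemma legendreMoment_eq {S : Set Plane} (hm : MeasurableSet S) (hS : S ⊆ unitSquare) (k l : ℕ) :
    legendreMoment k l S = ∫ z, planeIndicator S z * (legendreFun k z.1 * legendreFun l z.2)
      ∂(unitMeasure.prod unitMeasure) := by
  rw [integral_prod_unitMeasure fun z hz => by rw [planeIndicator_eq_zero hS hz, zero_mul],
    legendreMoment, ← integral_indicator hm]
  refine integral_congr_ae (ae_of_all _ fun x => ?_)
  have hx : planeEquiv.symm (x 0, x 1) = x := planeEquiv.symm_apply_apply x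
  by_cases h : x ∈ S
  · have h' : (x 0, x 1) ∈ planeEquiv.symm ⁻¹' S := by rwa [Set.mem_preimage, hx]
    simp only [planeIndicator, Set.indicator_of_mem h, Set.indicator_of_mem h', legendreFun,
      Set.indicator_of_mem (hS h 0), Set.indicator_of_mem (hS h 1), Pi.one_apply, one_mul]
  · have h' : (x 0, x 1) ∉ planeEquiv.symm ⁻¹' S := by rwa [Set.mem_preimage, hx]
    simp only [planeIndicator, Set.indicator_of_notMem h, Set.indicator_of_notMem h', zero_mul]

/-- The difference of two indicators takes values in `{-1, 0, 1}`, so its square is the indicator of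
the symmetric difference. -/
lemma nikodymDist_eq {S T : Set Plane} (hSm : MeasurableSet S) (hS : S ⊆ unitSquare)
    (hTm : MeasurableSet T) (hT : T ⊆ unitSquare) :
    nikodymDist S T = ∫ z, (planeIndicator S z - planeIndicator T z) ^ 2
      ∂(unitMeasure.prod unitMeasure) := by
  rw [integral_prod_unitMeasure fun z hz => by
    rw [planeIndicator_eq_zero hS hz, planeIndicator_eq_zero hT hz]; simp]
  rw [nikodymDist, ← integral_indicator_one (hSm.symmDiff hTm)]
  refine integral_congr_ae (ae_of_all _ fun x => ?_)
  have hx : planeEquiv.symm (x 0, x 1) = x := planeEquiv.symm_apply_apply x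
  by_cases h : x ∈ S <;> by_cases h' : x ∈ T <;>
    simp [planeIndicator, hx, h, h', Set.mem_symmDiff]

lemma momentError_eq {S T : Set Plane} (hSm : MeasurableSet S) (hS : S ⊆ unitSquare)
    (hTm : MeasurableSet T) (hT : T ⊆ unitSquare) (N : ℕ) :
    momentError N S T = ∑ k ∈ Finset.range (N + 1), ∑ l ∈ Finset.range (N + 1),
      (∫ z, (planeIndicator S z - planeIndicator T z) * (legendreFun k z.1 * legendreFun l z.2)
        ∂(unitMeasure.prod unitMeasure)) ^ 2 := by
  refine Finset.sum_congr rfl fun k _ => Finset.sum_congr rfl fun l _ => ?_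
  have hb := bddOrthonormal_legendreFun.prod.bddMeasurable (k, l)
  rw [legendreMoment_eq hSm hS, legendreMoment_eq hTm hT, ← integral_sub
    (((bddMeasurable_planeIndicator hSm).mul hb).integrable _)
    (((bddMeasurable_planeIndicator hTm).mul hb).integrable _)]
  simp_rw [sub_mul]

lemma momentError_le_nikodymDist {S T : Set Plane} (hSm : MeasurableSet S) (hS : S ⊆ unitSquare)
    (hTm : MeasurableSet T) (hT : T ⊆ unitSquare) (N : ℕ) :
    momentError N S T ≤ nikodymDist S T := by
  rw [momentError_eq hSm hS hTm hT, nikodymDist_eq hSm hS hTm hT]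
  exact sum_sq_integral_prod_le bddOrthonormal_legendreFun _
    ((bddMeasurable_planeIndicator hSm).sub (bddMeasurable_planeIndicator hTm))

lemma slice_properties {S : Set Plane} (hc : IsCompact S) (hconv : Convex ℝ S)
    (hS : S ⊆ unitSquare) {g : ℝ → Plane} (hg : Continuous g)
    (hg' : ∀ x y a b : ℝ, a + b = 1 → g (a * x + b * y) = a • g x + b • g y)
    (hg₁ : ∀ x, g x ∈ unitSquare → x ∈ Set.Icc (0 : ℝ) 1) :
    IsCompact (g ⁻¹' S) ∧ Convex ℝ (g ⁻¹' S) ∧ g ⁻¹' S ⊆ Set.Icc 0 1 := by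
  have hsub : g ⁻¹' S ⊆ Set.Icc 0 1 := fun x hx => hg₁ x (hS hx)
  refine ⟨isCompact_Icc.of_isClosed_subset (hc.isClosed.preimage hg) hsub, ?_, hsub⟩
  intro x hx y hy a b ha hb hab
  rw [Set.mem_preimage, smul_eq_mul, smul_eq_mul, hg' x y a b hab]
  exact hconv hx hy ha hb hab

lemma planeEquiv_symm_affine (z w : ℝ × ℝ) (a b : ℝ) :
    planeEquiv.symm (a • z + b • w) = a • planeEquiv.symm z + b • planeEquiv.symm w := by
  ext i
  fin_cases i <;> rfl

lemma continuous_planeEquiv_symm : Continuous planeEquiv.symm := by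
  have : (planeEquiv.symm : ℝ × ℝ → Plane) = fun z => !₂[z.1, z.2] := by
    funext z; ext i; fin_cases i <;> rfl
  rw [this]
  fun_prop

/-- The area of the symmetric difference of two compact convex sets is controlled by their first
Legendre moments. -/
lemma nikodymDist_le_momentError_add {S T : Set Plane} (hSc : IsCompact S) (hSconv : Convex ℝ S)
    (hS : S ⊆ unitSquare) (hTc : IsCompact T) (hTconv : Convex ℝ T) (hT : T ⊆ unitSquare) (N : ℕ) :
    nikodymDist S T ≤ momentError N S T + 64 / ((N : ℝ) + 1) := by
  have hSm := hSc.measurableSet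
  have hTm := hTc.measurableSet
  rw [momentError_eq hSm hS hTm hT, nikodymDist_eq hSm hS hTm hT]
  have h64 : 64 / ((N : ℝ) + 1) = 2 * (32 / ((N : ℝ) + 1)) := by ring
  rw [h64]
  refine integral_prod_sq_le bddOrthonormal_legendreFun _
    ((bddMeasurable_planeIndicator hSm).sub (bddMeasurable_planeIndicator hTm))
    (fun y => ?_) (fun x => ?_)
  · have hg : Continuous fun x : ℝ => planeEquiv.symm (x, y) :=
      continuous_planeEquiv_symm.comp (by fun_prop)
    have hg' : ∀ u v a b : ℝ, a + b = 1 → planeEquiv.symm (a * u + b * v, y) =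
        a • planeEquiv.symm (u, y) + b • planeEquiv.symm (v, y) := by
      intro u v a b hab
      rw [← planeEquiv_symm_affine]
      congr 1
      simp [← add_mul, hab]
    have hg₁ : ∀ u, planeEquiv.symm (u, y) ∈ unitSquare → u ∈ Set.Icc (0 : ℝ) 1 :=
      fun u hu => by simpa using hu 0
    obtain ⟨s1, s2, s3⟩ := slice_properties hSc hSconv hS hg hg' hg₁
    obtain ⟨t1, t2, t3⟩ := slice_properties hTc hTconv hT hg hg' hg₁
    exact projErr_indicator_sub_le s1 s2 s3 t1 t2 t3 N
  · have hg : Continuous fun y : ℝ => planeEquiv.symm (x, y) :=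
      continuous_planeEquiv_symm.comp (by fun_prop)
    have hg' : ∀ u v a b : ℝ, a + b = 1 → planeEquiv.symm (x, a * u + b * v) =
        a • planeEquiv.symm (x, u) + b • planeEquiv.symm (x, v) := by
      intro u v a b hab
      rw [← planeEquiv_symm_affine]
      congr 1
      simp [← add_mul, hab]
    have hg₁ : ∀ u, planeEquiv.symm (x, u) ∈ unitSquare → u ∈ Set.Icc (0 : ℝ) 1 :=
      fun u hu => by simpa using hu 1
    obtain ⟨s1, s2, s3⟩ := slice_properties hSc hSconv hS hg hg' hg₁
    obtain ⟨t1, t2, t3⟩ := slice_properties hTc hTconv hT hg hg' hg₁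
    exact projErr_indicator_sub_le s1 s2 s3 t1 t2 t3 N

/-! ### Area of a corner triangle. -/

lemma inner_direction (x : Plane) (φ : ℝ) :
    inner ℝ x (direction φ) = x 0 * Real.cos φ + x 1 * Real.sin φ := by
  simp [direction, PiLp.inner_apply, Fin.sum_univ_two, mul_comm]

lemma volume_standard_triangle_le :
    volume {w : Fin 2 → ℝ | 0 ≤ w 0 ∧ 0 ≤ w 1 ∧ w 0 + w 1 < 1} ≤ ENNReal.ofReal (1 / 2) := by
  have hm : MeasurableSet {z : ℝ × ℝ | 0 ≤ z.1 ∧ 0 ≤ z.2 ∧ z.1 + z.2 < 1} :=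
    (measurableSet_le measurable_const measurable_fst).inter
      ((measurableSet_le measurable_const measurable_snd).inter
        (measurableSet_lt (measurable_fst.add measurable_snd) measurable_const))
  have h := (volume_preserving_finTwoArrow ℝ).measure_preimage hm.nullMeasurableSet
  refine (show volume {w : Fin 2 → ℝ | 0 ≤ w 0 ∧ 0 ≤ w 1 ∧ w 0 + w 1 < 1} = _ from h).trans_le ?_
  rw [Measure.volume_eq_prod, Measure.prod_apply hm]
  have hle : ∀ x : ℝ, volume (Prod.mk x ⁻¹' {z : ℝ × ℝ | 0 ≤ z.1 ∧ 0 ≤ z.2 ∧ z.1 + z.2 < 1}) ≤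
      (Set.Icc (0 : ℝ) 1).indicator (fun x => ENNReal.ofReal (1 - x)) x := by
    intro x
    by_cases hx : x ∈ Set.Icc (0 : ℝ) 1
    · rw [Set.indicator_of_mem hx]
      refine (measure_mono (t := Set.Icc 0 (1 - x)) ?_).trans (by simp)
      rintro y ⟨_, h2, h3⟩
      exact ⟨h2, by simp only at h3; linarith⟩
    · rw [Set.indicator_of_notMem hx, nonpos_iff_eq_zero]
      convert measure_empty (μ := volume)
      ext y
      simp only [Set.mem_preimage, Set.mem_ofPred_eq, Set.mem_empty_iff_false, iff_false]
      rintro ⟨h1, h2, h3⟩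
      exact hx ⟨h1, by linarith⟩
  refine (lintegral_mono hle).trans ?_
  rw [lintegral_indicator measurableSet_Icc, ← ofReal_integral_eq_lintegral_ofReal]
  · rw [integral_Icc_eq_integral_Ioc, ← intervalIntegral.integral_of_le zero_le_one]
    refine ENNReal.ofReal_le_ofReal (le_of_eq ?_)
    rw [intervalIntegral.integral_sub (by simp) (by simp)]
    norm_num [integral_id]
  · exact (Continuous.continuousOn (by fun_prop)).integrableOn_Icc
  · exact (ae_restrict_iff' measurableSet_Icc).2 (ae_of_all _ fun x hx => sub_nonneg.2 hx.2)

/-- The triangle cut off by the lines `⟨x, direction α⟩ = a`, `⟨x, direction β⟩ = b` and the line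
that is at distances `ξ` and `η` from their intersection, measured by these two functionals. -/
def cornerTriangle (α β a b ξ η : ℝ) : Set Plane :=
  {x | inner ℝ x (direction α) ≤ a ∧ inner ℝ x (direction β) ≤ b ∧
    (a - inner ℝ x (direction α)) * η + (b - inner ℝ x (direction β)) * ξ < ξ * η}

/-- The normalized slacks in the directions `α` and `β` are affine coordinates taking the corner to
the standard triangle; their linear part has determinant of absolute value `sin (β - α) / (ξ * η)`.
If `ξ * η = 0`, the strict inequality makes the corner empty. -/
lemma volume_cornerTriangle_le {α β : ℝ} (hS : 0 < Real.sin (β - α)) (a b : ℝ) {ξ η : ℝ}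
    (hξ : 0 ≤ ξ) (hη : 0 ≤ η) :
    volume (cornerTriangle α β a b ξ η) ≤ ENNReal.ofReal (ξ * η / (2 * Real.sin (β - α))) := by
  by_cases h0 : ξ * η = 0
  · have : cornerTriangle α β a b ξ η = ∅ := by
      ext x
      simp only [cornerTriangle, Set.mem_ofPred_eq, Set.mem_empty_iff_false, iff_false, h0]
      rintro ⟨h1, h2, h3⟩
      nlinarith [mul_nonneg (sub_nonneg.2 h1) hη, mul_nonneg (sub_nonneg.2 h2) hξ]
    simp [this]
  have hξ' : 0 < ξ := hξ.lt_of_ne fun h => h0 (by simp [← h])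
  have hη' : 0 < η := hη.lt_of_ne fun h => h0 (by simp [← h])
  let A : Matrix (Fin 2) (Fin 2) ℝ :=
    !![Real.cos α / ξ, Real.sin α / ξ; Real.cos β / η, Real.sin β / η]
  have hdet : LinearMap.det (Matrix.toLin' A) = Real.sin (β - α) / (ξ * η) := by
    rw [LinearMap.det_toLin', Matrix.det_fin_two_of, Real.sin_sub]
    field_simp
  have hdet0 : LinearMap.det (Matrix.toLin' A) ≠ 0 := by rw [hdet]; positivity
  let T : Set (Fin 2 → ℝ) := {w | 0 ≤ w 0 ∧ 0 ≤ w 1 ∧ w 0 + w 1 < 1}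
  let c : Fin 2 → ℝ := ![a / ξ, b / η]
  have hTm : MeasurableSet T :=
    (measurableSet_le measurable_const (measurable_pi_apply 0)).inter
      ((measurableSet_le measurable_const (measurable_pi_apply 1)).inter
        (measurableSet_lt ((measurable_pi_apply 0).add (measurable_pi_apply 1)) measurable_const))
  have hT1 : volume ((fun w => c - w) ⁻¹' T) = volume T :=
    (Measure.measurePreserving_sub_left volume c).measure_preimage hTm.nullMeasurableSet
  have hT2 := Measure.addHaar_preimage_linearMap volume hdet0 ((fun w => c - w) ⁻¹' T)
  have hT3 := (EuclideanSpace.volume_preserving_symm_measurableEquiv_toLp (Fin 2)).measure_preimage_equiv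
    (Matrix.toLin' A ⁻¹' ((fun w => c - w) ⁻¹' T))
  have hset : cornerTriangle α β a b ξ η = (MeasurableEquiv.toLp 2 (Fin 2 → ℝ)).symm ⁻¹'
      (Matrix.toLin' A ⁻¹' ((fun w => c - w) ⁻¹' T)) := by
    ext x
    have e0 : (c - Matrix.toLin' A ((MeasurableEquiv.toLp 2 (Fin 2 → ℝ)).symm x)) 0 =
        (a - inner ℝ x (direction α)) / ξ := by
      simp [c, A, inner_direction, dotProduct, Fin.sum_univ_two]
      ring
    have e1 : (c - Matrix.toLin' A ((MeasurableEquiv.toLp 2 (Fin 2 → ℝ)).symm x)) 1 =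
        (b - inner ℝ x (direction β)) / η := by
      simp [c, A, inner_direction, dotProduct, Fin.sum_univ_two]
      ring
    simp only [Set.mem_preimage, T, Set.mem_ofPred_eq, e0, e1, cornerTriangle]
    rw [le_div_iff₀ hξ', le_div_iff₀ hη', zero_mul, zero_mul, sub_nonneg, sub_nonneg,
      div_add_div _ _ hξ'.ne' hη'.ne', div_lt_one (by positivity), mul_comm ξ (b - _)]
  rw [hset, hT3, hT2, hT1, hdet, abs_of_pos (by positivity)]
  refine (mul_le_mul_right volume_standard_triangle_le _).trans (le_of_eq ?_)
  rw [← ENNReal.ofReal_mul (by positivity)]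
  congr 1
  field_simp

lemma tan_half_eq {δ : ℝ} (hδ : 0 < Real.sin δ) :
    Real.tan (δ / 2) = Real.sin δ / (1 + Real.cos δ) := by
  have h1 : Real.sin δ = 2 * Real.sin (δ / 2) * Real.cos (δ / 2) := by
    rw [← Real.sin_two_mul]; ring_nf
  have h2 : Real.cos δ = 2 * Real.cos (δ / 2) ^ 2 - 1 := by
    rw [← Real.cos_two_mul]; ring_nf
  have hc : Real.cos (δ / 2) ≠ 0 := by
    intro h; rw [h1, h] at hδ; simp at hδ
  rw [Real.tan_eq_sin_div_cos, h1, h2]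
  field_simp
  ring

lemma one_add_cos_pos {δ : ℝ} (hδ : 0 < Real.sin δ) : 0 < 1 + Real.cos δ := by
  have := Real.neg_one_le_cos δ
  refine lt_of_le_of_ne (by linarith) fun h => ?_
  have h2 := Real.sin_sq_add_cos_sq δ
  have : Real.cos δ = -1 := by linarith
  rw [this] at h2
  nlinarith

/-- Among triangles with given base and apex angle the isosceles one is largest. Here `(x, y)` is
the base vector: the law of cosines is `key`, and `2ξη ≤ ξ² + η²` gives the bound whatever the signs
of `ξ` and `η`. -/
lemma corner_area_le {α β : ℝ} (hS : 0 < Real.sin (β - α)) (x y : ℝ) :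
    -(x * Real.cos α + y * Real.sin α) * (x * Real.cos β + y * Real.sin β) /
      (2 * Real.sin (β - α)) ≤ (x ^ 2 + y ^ 2) / 4 * Real.tan ((β - α) / 2) := by
  have hC := one_add_cos_pos hS
  rw [tan_half_eq hS]
  set ξ := -(x * Real.cos α + y * Real.sin α) with hξ
  set η := x * Real.cos β + y * Real.sin β with hη
  have key : Real.sin (β - α) ^ 2 * (x ^ 2 + y ^ 2) =
      ξ ^ 2 + η ^ 2 + 2 * ξ * η * Real.cos (β - α) := by
    rw [hξ, hη, Real.sin_sub, Real.cos_sub]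
    have h1 := Real.sin_sq_add_cos_sq α
    have h2 := Real.sin_sq_add_cos_sq β
    have h1' : Real.sin α ^ 2 = 1 - Real.cos α ^ 2 := by linarith
    have h2' : Real.sin β ^ 2 = 1 - Real.cos β ^ 2 := by linarith
    ring_nf
    simp only [h1', h2']
    ring
  have key2 : ξ * η * (2 * (1 + Real.cos (β - α))) ≤ Real.sin (β - α) ^ 2 * (x ^ 2 + y ^ 2) := by
    nlinarith [sq_nonneg (ξ - η)]
  rw [div_mul_div_comm, div_le_div_iff₀ (by positivity) (by positivity)]
  nlinarith

/-- Since `φ` lies between `α` and `β`, the separating functional is a nonnegative combination of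
the functionals in those two directions (`hdec`). Separation from both `p` and `q` then puts `x`
beyond the line joining them. -/
lemma mem_cornerTriangle_of_separated {A B α β φ r : ℝ} (hr : 0 < r)
    (hA : A = r * Real.cos φ) (hB : B = r * Real.sin φ)
    (h1 : 0 < Real.sin (β - φ)) (h2 : 0 ≤ Real.sin (φ - α)) (hS : 0 < Real.sin (β - α))
    {x p q : Plane} (hx1 : inner ℝ x (direction α) ≤ inner ℝ p (direction α))
    (hx2 : inner ℝ x (direction β) ≤ inner ℝ q (direction β))
    (hp : A * p 0 + B * p 1 < A * x 0 + B * x 1) (hq : A * q 0 + B * q 1 < A * x 0 + B * x 1) :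
    x ∈ cornerTriangle α β (inner ℝ p (direction α)) (inner ℝ q (direction β))
      (inner ℝ p (direction α) - inner ℝ q (direction α))
      (inner ℝ q (direction β) - inner ℝ p (direction β)) := by
  refine ⟨hx1, hx2, ?_⟩
  have hdec : ∀ z : Plane, Real.sin (β - α) * (A * z 0 + B * z 1) =
      r * Real.sin (β - φ) * inner ℝ z (direction α) +
        r * Real.sin (φ - α) * inner ℝ z (direction β) := by
    intro z
    simp only [inner_direction, hA, hB, Real.sin_sub]
    ring
  have hp' := mul_lt_mul_of_pos_left hp hS
  have hq' := mul_lt_mul_of_pos_left hq hS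
  rw [hdec, hdec] at hp' hq'
  set a := r * Real.sin (β - φ) with ha
  set b := r * Real.sin (φ - α) with hb
  have ha0 : 0 < a := by positivity
  have hb0 : 0 ≤ b := by positivity
  set xa := (inner ℝ x (direction α) : ℝ)
  set xb := (inner ℝ x (direction β) : ℝ)
  set pa := (inner ℝ p (direction α) : ℝ)
  set pb := (inner ℝ p (direction β) : ℝ)
  set qa := (inner ℝ q (direction α) : ℝ)
  set qb := (inner ℝ q (direction β) : ℝ)
  have hX : 0 ≤ a * (pa - xa) := mul_nonneg ha0.le (sub_nonneg.2 hx1)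
  have hY : 0 ≤ b * (qb - xb) := mul_nonneg hb0 (sub_nonneg.2 hx2)
  have hR : a * (pa - xa) + b * (qb - xb) < b * (qb - pb) := by linarith
  have hP : a * (pa - xa) + b * (qb - xb) < a * (pa - qa) := by linarith
  -- The case `φ = α` cannot occur: then `p` would maximize the separating functional under the
  -- constraint `hx1`.
  have hb1 : 0 < b := by
    rcases hb0.eq_or_lt with h | h
    · rw [← h] at hR
      linarith
    · exact h
  have : (a * b) * ((pa - xa) * (qb - pb) + (qb - xb) * (pa - qa)) <
      (a * b) * ((pa - qa) * (qb - pb)) := by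
    have e1 : (a * b) * ((pa - xa) * (qb - pb) + (qb - xb) * (pa - qa)) =
      (a * (pa - xa)) * (b * (qb - pb)) + (b * (qb - xb)) * (a * (pa - qa)) := by ring
    have e2 : (a * b) * ((pa - qa) * (qb - pb)) = (a * (pa - qa)) * (b * (qb - pb)) := by ring
    rw [e1, e2]
    generalize a * (pa - xa) = X at *
    generalize b * (qb - xb) = Y at *
    generalize b * (qb - pb) = R at *
    generalize a * (pa - qa) = P at *
    -- From `X + Y < min P R` and `X, Y ≥ 0` follows `X * R + Y * P ≤ (X + Y) * max P R < P * R`.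
    rcases le_total P R with h | h
    · nlinarith [mul_le_mul_of_nonneg_left h hY]
    · nlinarith [mul_le_mul_of_nonneg_left h hX]
  exact lt_of_mul_lt_mul_left this (by positivity)

lemma exists_polar {A B : ℝ} (h : A ≠ 0 ∨ B ≠ 0) :
    ∃ r φ : ℝ, 0 < r ∧ 0 ≤ φ ∧ φ < 2 * Real.pi ∧ A = r * Real.cos φ ∧ B = r * Real.sin φ := by
  let z : ℂ := ⟨A, B⟩
  have hz : z ≠ 0 := by
    intro hz
    rcases h with h | h
    · exact h (congrArg Complex.re hz)
    · exact h (congrArg Complex.im hz)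
  have hre : A = ‖z‖ * Real.cos z.arg := (Complex.norm_mul_cos_arg z).symm
  have him : B = ‖z‖ * Real.sin z.arg := (Complex.norm_mul_sin_arg z).symm
  have hpi := Real.pi_pos
  have h1 := Complex.neg_pi_lt_arg z
  have h2 := Complex.arg_le_pi z
  rcases le_or_gt 0 z.arg with h0 | h0
  · exact ⟨‖z‖, z.arg, norm_pos_iff.2 hz, h0, by linarith, hre, him⟩
  · refine ⟨‖z‖, z.arg + 2 * Real.pi, norm_pos_iff.2 hz, by linarith, by linarith, ?_, ?_⟩
    · rw [Real.cos_add_two_pi]; exact hre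
    · rw [Real.sin_add_two_pi]; exact him

/-! ### Covering the complement of a convex set by corners. -/

/-- Angles `0 = θ 0 < θ 1 < … < θ m = 2π` that contain the four axis directions. -/
structure AxisPartition (m : ℕ) (θ : ℕ → ℝ) (k₁ k₂ k₃ : ℕ) : Prop where
  strictMono : ∀ i j, i < j → j ≤ m → θ i < θ j
  le₁ : k₁ ≤ k₂
  le₂ : k₂ ≤ k₃
  le₃ : k₃ ≤ m
  zero : θ 0 = 0
  one : θ k₁ = Real.pi / 2
  two : θ k₂ = Real.pi
  three : θ k₃ = 3 * Real.pi / 2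
  last : θ m = 2 * Real.pi

namespace AxisPartition

variable {m : ℕ} {θ : ℕ → ℝ} {k₁ k₂ k₃ : ℕ}

lemma mono (hθ : AxisPartition m θ k₁ k₂ k₃) {i j : ℕ} (hij : i ≤ j) (hj : j ≤ m) :
    θ i ≤ θ j := by
  rcases hij.eq_or_lt with rfl | h
  · exact le_rfl
  · exact (hθ.strictMono i j h hj).le

lemma gap_le (hθ : AxisPartition m θ k₁ k₂ k₃) {j : ℕ} (hj : j < m) :
    θ (j + 1) - θ j ≤ Real.pi / 2 := by
  have h12 := hθ.le₁
  have h23 := hθ.le₂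
  have h3 := hθ.le₃
  have z := hθ.zero; have o := hθ.one; have t := hθ.two; have th := hθ.three; have l := hθ.last
  rcases lt_or_ge j k₁ with h | h
  · have a := hθ.mono (Nat.zero_le j) hj.le
    have b := hθ.mono (Nat.succ_le_of_lt h) (by omega)
    simp only [Nat.succ_eq_add_one] at b
    linarith
  rcases lt_or_ge j k₂ with h' | h'
  · have a := hθ.mono h hj.le
    have b := hθ.mono (Nat.succ_le_of_lt h') (by omega)
    simp only [Nat.succ_eq_add_one] at b
    linarith
  rcases lt_or_ge j k₃ with h'' | h''
  · have a := hθ.mono h' hj.le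
    have b := hθ.mono (Nat.succ_le_of_lt h'') (by omega)
    simp only [Nat.succ_eq_add_one] at b
    linarith
  · have a := hθ.mono h'' hj.le
    have b := hθ.mono (Nat.succ_le_of_lt hj) le_rfl
    simp only [Nat.succ_eq_add_one] at b
    linarith

lemma sin_gap_pos (hθ : AxisPartition m θ k₁ k₂ k₃) {j : ℕ} (hj : j < m) :
    0 < Real.sin (θ (j + 1) - θ j) := by
  have := hθ.gap_le hj
  have := hθ.strictMono j (j + 1) (Nat.lt_succ_self j) hj
  have := Real.pi_pos
  exact Real.sin_pos_of_pos_of_lt_pi (by linarith) (by linarith)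

end AxisPartition

lemma exists_bracket {θ : ℕ → ℝ} {m : ℕ} {φ : ℝ} (h0 : θ 0 ≤ φ) (hm : φ < θ m) :
    ∃ j < m, θ j ≤ φ ∧ φ < θ (j + 1) := by
  induction m with
  | zero => exact absurd hm (not_lt.2 h0)
  | succ m ih =>
    rcases lt_or_ge φ (θ m) with h | h
    · obtain ⟨j, hj, h'⟩ := ih h
      exact ⟨j, by omega, h'⟩
    · exact ⟨m, Nat.lt_succ_self m, h, hm⟩

/-- The corner between the `j`-th and the `(j+1)`-st supporting line with contact points `p`. -/
def corner (θ : ℕ → ℝ) (p : ℕ → Plane) (j : ℕ) : Set Plane :=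
  cornerTriangle (θ j) (θ (j + 1)) (inner ℝ (p j) (direction (θ j)))
    (inner ℝ (p (j + 1)) (direction (θ (j + 1))))
    (inner ℝ (p j) (direction (θ j)) - inner ℝ (p (j + 1)) (direction (θ j)))
    (inner ℝ (p (j + 1)) (direction (θ (j + 1))) - inner ℝ (p j) (direction (θ (j + 1))))

/-- A line separates `x` from `K`. The angle of its normal falls between two consecutive `θ j`,
which identifies the corner containing `x`. -/
lemma exists_mem_corner {m : ℕ} {θ : ℕ → ℝ} {k₁ k₂ k₃ : ℕ} (hθ : AxisPartition m θ k₁ k₂ k₃)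
    {K : Set Plane} (hK : IsCompact K) (hconv : Convex ℝ K) {p : ℕ → Plane}
    (hpK : ∀ j, p j ∈ K) {x : Plane} (hxK : x ∉ K)
    (hx : ∀ j ≤ m, inner ℝ x (direction (θ j)) ≤ inner ℝ (p j) (direction (θ j))) :
    ∃ j < m, x ∈ corner θ p j := by
  obtain ⟨f, u, hf, hu⟩ := geometric_hahn_banach_closed_point hconv hK.isClosed hxK
  obtain ⟨A, B, hAB⟩ : ∃ A B : ℝ, ∀ z : Plane, f z = A * z 0 + B * z 1 := by
    refine ⟨f (EuclideanSpace.single 0 1), f (EuclideanSpace.single 1 1), fun z => ?_⟩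
    have hz : z = z 0 • EuclideanSpace.single 0 (1 : ℝ) + z 1 • EuclideanSpace.single 1 (1 : ℝ) := by
      ext i; fin_cases i <;> simp
    conv_lhs => rw [hz]
    simp [mul_comm]
  have hsep : ∀ z ∈ K, A * z 0 + B * z 1 < A * x 0 + B * x 1 := fun z hz => by
    rw [← hAB, ← hAB]; exact (hf z hz).trans hu
  have hne : A ≠ 0 ∨ B ≠ 0 := by
    by_contra! h
    have := hsep _ (hpK 0)
    simp [h.1, h.2] at this
  obtain ⟨r, φ, hr, h0, h2, hA, hB⟩ := exists_polar hne
  obtain ⟨j, hj, h1, h2⟩ := exists_bracket (θ := θ) (m := m) (φ := φ) (by rw [hθ.zero]; exact h0)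
    (by rw [hθ.last]; exact h2)
  have hg := hθ.gap_le hj
  have hpi := Real.pi_pos
  exact ⟨j, hj, mem_cornerTriangle_of_separated hr hA hB
    (Real.sin_pos_of_pos_of_lt_pi (by linarith) (by linarith))
    (Real.sin_nonneg_of_nonneg_of_le_pi (by linarith) (by linarith)) (hθ.sin_gap_pos hj)
    (hx j hj.le) (hx (j + 1) hj) (hsep _ (hpK j)) (hsep _ (hpK (j + 1)))⟩

/-! ### Squared side lengths of the contact polygon. -/

lemma sq_le_sign_mul {d ε S a b s t : ℝ} (hε : ε = 1 ∨ ε = -1) (hd : |d| ≤ 1) (hS : 0 < S)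
    (ha : 0 ≤ a) (hb : 0 ≤ b) (h : S * d = a * s + b * t) (hs : 0 ≤ ε * s) (ht : 0 ≤ ε * t) :
    d ^ 2 ≤ ε * d := by
  have hpos : 0 ≤ ε * d := by
    have : 0 ≤ S * (ε * d) := by
      have : S * (ε * d) = a * (ε * s) + b * (ε * t) := by linear_combination ε * h
      rw [this]; positivity
    exact nonneg_of_mul_nonneg_right this hS
  have habs : |d| = ε * d := by
    rcases hε with rfl | rfl
    · rw [one_mul] at hpos ⊢; exact abs_of_nonneg hpos
    · rw [abs_of_nonpos (by linarith)]; ring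
  rw [← habs, ← sq_abs]
  nlinarith [abs_nonneg d]

/-- Each side is a nonnegative combination of the tangents `(-sin, cos)` at its two angles, so
within one quadrant of normals both coordinates of the contact points are monotone. Increments are
at most `1` in absolute value, hence their squares are at most the signed increments, which
telescope. -/
lemma sum_sq_le_of_quadrant {θ : ℕ → ℝ} {p : ℕ → Plane} {a b : ℕ} (hab : a ≤ b) {ε δ : ℝ}
    (hε : ε = 1 ∨ ε = -1) (hδ : δ = 1 ∨ δ = -1)
    (hS : ∀ j, a ≤ j → j < b → 0 < Real.sin (θ (j + 1) - θ j))
    (hsin : ∀ j, a ≤ j → j ≤ b → ε * Real.sin (θ j) ≤ 0)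
    (hcos : ∀ j, a ≤ j → j ≤ b → 0 ≤ δ * Real.cos (θ j))
    (hsq : ∀ j, p j ∈ unitSquare)
    (h1 : ∀ j, a ≤ j → j < b →
      inner ℝ (p (j + 1)) (direction (θ j)) ≤ inner ℝ (p j) (direction (θ j)))
    (h2 : ∀ j, a ≤ j → j < b →
      inner ℝ (p j) (direction (θ (j + 1))) ≤ inner ℝ (p (j + 1)) (direction (θ (j + 1)))) :
    ∑ j ∈ Finset.Ico a b, ((p (j + 1) 0 - p j 0) ^ 2 + (p (j + 1) 1 - p j 1) ^ 2) ≤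
      ε * (p b 0 - p a 0) + δ * (p b 1 - p a 1) := by
  have hle : ∀ j ∈ Finset.Ico a b,
      (p (j + 1) 0 - p j 0) ^ 2 + (p (j + 1) 1 - p j 1) ^ 2 ≤
        ε * (p (j + 1) 0 - p j 0) + δ * (p (j + 1) 1 - p j 1) := by
    intro j hj
    obtain ⟨hj1, hj2⟩ := Finset.mem_Ico.1 hj
    have habs : ∀ k, |p (j + 1) k - p j k| ≤ 1 := fun k => by
      rw [abs_le]
      constructor <;> linarith [(hsq j k).1, (hsq j k).2, (hsq (j + 1) k).1, (hsq (j + 1) k).2]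
    have i1 := h1 j hj1 hj2
    have i2 := h2 j hj1 hj2
    rw [← sub_nonneg] at i1 i2
    refine add_le_add (sq_le_sign_mul hε (habs 0) (hS j hj1 hj2) i2 i1
      (s := -Real.sin (θ j)) (t := -Real.sin (θ (j + 1))) ?_ ?_ ?_)
      (sq_le_sign_mul hδ (habs 1) (hS j hj1 hj2) i2 i1
      (s := Real.cos (θ j)) (t := Real.cos (θ (j + 1))) ?_ ?_ ?_)
    · simp only [inner_direction, Real.sin_sub]; ring
    · linarith [hsin j hj1 hj2.le]
    · linarith [hsin (j + 1) (by omega) hj2]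
    · simp only [inner_direction, Real.sin_sub]; ring
    · exact hcos j hj1 hj2.le
    · exact hcos (j + 1) (by omega) hj2
  refine (Finset.sum_le_sum hle).trans (le_of_eq ?_)
  rw [Finset.sum_add_distrib, ← Finset.mul_sum, ← Finset.mul_sum,
    Finset.sum_Ico_sub (fun j => p j 0) hab, Finset.sum_Ico_sub (fun j => p j 1) hab]

/-- The squared side lengths of the polygon of contact points add up to at most `4`. -/
lemma sum_sq_contact_le {m : ℕ} {θ : ℕ → ℝ} {k₁ k₂ k₃ : ℕ} (hθ : AxisPartition m θ k₁ k₂ k₃)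
    {p : ℕ → Plane} (hsq : ∀ j, p j ∈ unitSquare) (hper : p m = p 0)
    (hp : ∀ i j, inner ℝ (p i) (direction (θ j)) ≤ inner ℝ (p j) (direction (θ j))) :
    ∑ j ∈ Finset.range m, ((p (j + 1) 0 - p j 0) ^ 2 + (p (j + 1) 1 - p j 1) ^ 2) ≤ 4 := by
  have h12 := hθ.le₁
  have h23 := hθ.le₂
  have h3 := hθ.le₃
  have hz := hθ.zero
  have ho := hθ.one
  have ht := hθ.two
  have hth := hθ.three
  have hl := hθ.last
  have hpi := Real.pi_pos
  have hcos_shift : ∀ t, Real.cos t = -Real.cos (t - Real.pi) := fun t => by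
    rw [Real.cos_sub_pi, neg_neg]
  have hsin_shift : ∀ t, Real.sin t = -Real.sin (t - Real.pi) := fun t => by
    rw [Real.sin_sub_pi, neg_neg]
  have q1 := sum_sq_le_of_quadrant (θ := θ) (p := p) (Nat.zero_le k₁) (ε := -1) (δ := 1)
    (Or.inr rfl) (Or.inl rfl) (fun j _ hj => hθ.sin_gap_pos (by omega))
    (fun j h h' => by
      have a := hθ.mono h (by omega)
      have b := hθ.mono h' (by omega)
      have := Real.sin_nonneg_of_nonneg_of_le_pi (x := θ j) (by linarith) (by linarith)
      linarith)
    (fun j h h' => by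
      have a := hθ.mono h (by omega)
      have b := hθ.mono h' (by omega)
      have := Real.cos_nonneg_of_neg_pi_div_two_le_of_le (x := θ j) (by linarith) (by linarith)
      linarith)
    hsq (fun j _ _ => hp _ _) (fun j _ _ => hp _ _)
  have q2 := sum_sq_le_of_quadrant (θ := θ) (p := p) h12 (ε := -1) (δ := -1)
    (Or.inr rfl) (Or.inr rfl) (fun j _ hj => hθ.sin_gap_pos (by omega))
    (fun j h h' => by
      have a := hθ.mono h (by omega)
      have b := hθ.mono h' (by omega)
      have := Real.sin_nonneg_of_nonneg_of_le_pi (x := θ j) (by linarith) (by linarith)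
      linarith)
    (fun j h h' => by
      have a := hθ.mono h (by omega)
      have b := hθ.mono h' (by omega)
      have := Real.cos_nonpos_of_pi_div_two_le_of_le (x := θ j) (by linarith) (by linarith)
      linarith)
    hsq (fun j _ _ => hp _ _) (fun j _ _ => hp _ _)
  have q3 := sum_sq_le_of_quadrant (θ := θ) (p := p) h23 (ε := 1) (δ := -1)
    (Or.inl rfl) (Or.inr rfl) (fun j _ hj => hθ.sin_gap_pos (by omega))
    (fun j h h' => by
      have a := hθ.mono h (by omega)
      have b := hθ.mono h' (by omega)
      have := Real.sin_nonneg_of_nonneg_of_le_pi (x := θ j - Real.pi) (by linarith) (by linarith)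
      rw [hsin_shift]
      linarith)
    (fun j h h' => by
      have a := hθ.mono h (by omega)
      have b := hθ.mono h' (by omega)
      have := Real.cos_nonpos_of_pi_div_two_le_of_le (x := θ j) (by linarith) (by linarith)
      linarith)
    hsq (fun j _ _ => hp _ _) (fun j _ _ => hp _ _)
  have q4 := sum_sq_le_of_quadrant (θ := θ) (p := p) h3 (ε := 1) (δ := 1)
    (Or.inl rfl) (Or.inl rfl) (fun j _ hj => hθ.sin_gap_pos (by omega))
    (fun j h h' => by
      have a := hθ.mono h (by omega)
      have b := hθ.mono h' (by omega)
      have := Real.sin_nonneg_of_nonneg_of_le_pi (x := θ j - Real.pi) (by linarith) (by linarith)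
      rw [hsin_shift]
      linarith)
    (fun j h h' => by
      have a := hθ.mono h (by omega)
      have b := hθ.mono h' (by omega)
      have := Real.cos_nonpos_of_pi_div_two_le_of_le (x := θ j - Real.pi)
        (by linarith) (by linarith)
      rw [hcos_shift]
      linarith)
    hsq (fun j _ _ => hp _ _) (fun j _ _ => hp _ _)
  rw [Finset.range_eq_Ico, ← Finset.sum_Ico_consecutive _ (Nat.zero_le k₃) h3,
    ← Finset.sum_Ico_consecutive _ (Nat.zero_le k₂) h23,
    ← Finset.sum_Ico_consecutive _ (Nat.zero_le k₁) h12]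
  rw [hper] at q4
  -- The four telescoped sums add up to the perimeter of the bounding box, twice its width plus
  -- twice its height.
  linarith [(hsq 0 0).2, (hsq k₂ 0).1, (hsq k₁ 1).2, (hsq k₃ 1).1]

/-- The area between a convex set and its circumscribed polygon. -/
lemma volume_circumscribed_diff_le {m : ℕ} {θ : ℕ → ℝ} {k₁ k₂ k₃ : ℕ}
    (hθ : AxisPartition m θ k₁ k₂ k₃) {K : Set Plane} (hK : IsCompact K) (hconv : Convex ℝ K)
    (hKsq : K ⊆ unitSquare) {p : ℕ → Plane} (hpK : ∀ j, p j ∈ K) (hper : p m = p 0)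
    (hp : ∀ j, ∀ x ∈ K, inner ℝ x (direction (θ j)) ≤ inner ℝ (p j) (direction (θ j)))
    {Q : Set Plane}
    (hQ : ∀ x ∈ Q, ∀ j ≤ m, inner ℝ x (direction (θ j)) ≤ inner ℝ (p j) (direction (θ j)))
    {M : ℝ} (hM0 : 0 ≤ M) (hM : ∀ j < m, Real.tan ((θ (j + 1) - θ j) / 2) ≤ M) :
    volume.real (Q \ K) ≤ M := by
  set D : ℕ → ℝ := fun j => (p (j + 1) 0 - p j 0) ^ 2 + (p (j + 1) 1 - p j 1) ^ 2 with hD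
  have hDnn : ∀ j, 0 ≤ D j := fun j => by positivity
  have hcover : Q \ K ⊆ ⋃ j ∈ Finset.range m, corner θ p j := by
    rintro x ⟨hxQ, hxK⟩
    obtain ⟨j, hj, hxj⟩ := exists_mem_corner hθ hK hconv hpK hxK (hQ x hxQ)
    exact Set.mem_biUnion (Finset.mem_coe.2 (Finset.mem_range.2 hj)) hxj
  have hvol : ∀ j ∈ Finset.range m, volume (corner θ p j) ≤ ENNReal.ofReal (D j / 4 * M) := by
    intro j hj
    have hj := Finset.mem_range.1 hj
    refine (volume_cornerTriangle_le (hθ.sin_gap_pos hj) _ _ (sub_nonneg.2 (hp _ _ (hpK _)))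
      (sub_nonneg.2 (hp _ _ (hpK _)))).trans (ENNReal.ofReal_le_ofReal ?_)
    have := corner_area_le (hθ.sin_gap_pos hj) (p (j + 1) 0 - p j 0) (p (j + 1) 1 - p j 1)
    refine le_trans (le_of_eq ?_) (this.trans
      (mul_le_mul_of_nonneg_left (hM j hj) (div_nonneg (hDnn j) (by norm_num))))
    simp only [inner_direction]
    congr 1
    ring
  have hsum : ∑ j ∈ Finset.range m, D j ≤ 4 :=
    sum_sq_contact_le hθ (fun j => hKsq (hpK j)) hper fun i j => hp j _ (hpK i)
  refine ENNReal.toReal_le_of_le_ofReal hM0 ?_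
  calc volume (Q \ K) ≤ volume (⋃ j ∈ Finset.range m, corner θ p j) := measure_mono hcover
    _ ≤ ∑ j ∈ Finset.range m, volume (corner θ p j) := measure_biUnion_finset_le _ _
    _ ≤ ∑ j ∈ Finset.range m, ENNReal.ofReal (D j / 4 * M) := Finset.sum_le_sum hvol
    _ = ENNReal.ofReal (∑ j ∈ Finset.range m, D j / 4 * M) :=
      (ENNReal.ofReal_sum_of_nonneg fun j _ => by have := hDnn j; positivity).symm
    _ ≤ ENNReal.ofReal M := by
      refine ENNReal.ofReal_le_ofReal ?_
      rw [← Finset.sum_mul, ← Finset.sum_div]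
      nlinarith

/-! ### The circumscribed polygon as a member of the class. -/

lemma isClosed_polygon {n : ℕ} (θ h : Fin n → ℝ) : IsClosed (polygon θ h) := by
  have : polygon θ h = ⋂ i, {x : Plane | inner ℝ x (direction (θ i)) ≤ h i} := by
    ext x; simp [polygon]
  rw [this]
  exact isClosed_iInter fun i => isClosed_le (by fun_prop) continuous_const

lemma convex_polygon {n : ℕ} (θ h : Fin n → ℝ) : Convex ℝ (polygon θ h) := by
  intro x hx y hy a b ha hb hab i
  rw [inner_add_left, real_inner_smul_left, real_inner_smul_left]
  calc _ ≤ a * h i + b * h i :=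
        add_le_add (mul_le_mul_of_nonneg_left (hx i) ha) (mul_le_mul_of_nonneg_left (hy i) hb)
    _ = h i := by rw [← add_mul, hab, one_mul]

lemma isBounded_unitSquare : Bornology.IsBounded unitSquare := by
  refine isBounded_iff_forall_norm_le.2 ⟨2, fun x hx => ?_⟩
  have h0 := hx 0
  have h1 := hx 1
  rw [EuclideanSpace.norm_eq, Real.sqrt_le_left (by norm_num)]
  simp only [Fin.sum_univ_two, Real.norm_eq_abs, sq_abs]
  nlinarith [h0.1, h0.2, h1.1, h1.2]

lemma polygonClass_isCompact_convex {n : ℕ} {θ : Fin n → ℝ} {P : Set Plane}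
    (hP : P ∈ polygonClass θ) : IsCompact P ∧ Convex ℝ P := by
  obtain ⟨hsub, h, -, rfl⟩ := hP
  exact ⟨Metric.isCompact_of_isClosed_isBounded (isClosed_polygon θ h)
    (isBounded_unitSquare.subset hsub), convex_polygon θ h⟩

lemma exists_contact {K : Set Plane} (hK : IsCompact K) (hne : K.Nonempty) (u : Plane) :
    ∃ p ∈ K, ∀ x ∈ K, inner ℝ x u ≤ inner ℝ p u :=
  hK.exists_isMaxOn hne (f := fun x : Plane => (inner ℝ x u : ℝ)) (by fun_prop)

lemma consistent_of_contact {n : ℕ} {θ : Fin n → ℝ} {p : Fin n → Plane} {K : Set Plane}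
    (hne : K.Nonempty) (hpK : ∀ i, p i ∈ K)
    (hp : ∀ i, ∀ x ∈ K, inner ℝ x (direction (θ i)) ≤ inner ℝ (p i) (direction (θ i))) :
    Consistent θ fun i => inner ℝ (p i) (direction (θ i)) := by
  have hsub : K ⊆ polygon θ fun i => inner ℝ (p i) (direction (θ i)) := fun x hx i => hp i x hx
  refine ⟨hne.mono hsub, fun i => ?_⟩
  refine IsGreatest.csSup_eq ⟨⟨p i, hsub (hpK i), rfl⟩, ?_⟩
  rintro _ ⟨x, hx, rfl⟩
  exact hx i

/-- The four axis directions alone confine the polygon to a box whose sides pass through points of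
the square. -/
lemma polygon_subset_unitSquare {n : ℕ} {θ : Fin n → ℝ} {p : Fin n → Plane}
    (hp : ∀ i, p i ∈ unitSquare) (h0 : 0 ∈ Set.range θ) (h1 : Real.pi / 2 ∈ Set.range θ)
    (h2 : Real.pi ∈ Set.range θ) (h3 : 3 * Real.pi / 2 ∈ Set.range θ) :
    (polygon θ fun i => inner ℝ (p i) (direction (θ i))) ⊆ unitSquare := by
  obtain ⟨i0, h0⟩ := h0
  obtain ⟨i1, h1⟩ := h1
  obtain ⟨i2, h2⟩ := h2
  obtain ⟨i3, h3⟩ := h3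
  have e : 3 * Real.pi / 2 = Real.pi / 2 + Real.pi := by ring
  intro x hx
  have a0 := hx i0
  have a1 := hx i1
  have a2 := hx i2
  have a3 := hx i3
  simp only [inner_direction, h0, h1, h2, h3, e, Real.cos_add_pi, Real.sin_add_pi, Real.cos_zero,
    Real.sin_zero, Real.cos_pi_div_two, Real.sin_pi_div_two, Real.cos_pi, Real.sin_pi] at a0 a1 a2 a3
  have b0 := (hp i0 0).2
  have b1 := (hp i1 1).2
  have b2 := (hp i2 0).1
  have b3 := (hp i3 1).1
  intro k
  fin_cases k
  · exact ⟨by simp only [Fin.zero_eta]; linarith, by simp only [Fin.zero_eta]; linarith⟩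
  · exact ⟨by simp only [Fin.mk_one]; linarith, by simp only [Fin.mk_one]; linarith⟩

/-- The angles `θ`, continued by `2π`. -/
noncomputable def extendAngles {n : ℕ} (θ : Fin n → ℝ) (j : ℕ) : ℝ :=
  if h : j < n then θ ⟨j, h⟩ else 2 * Real.pi

lemma extendAngles_val {n : ℕ} (θ : Fin n → ℝ) (i : Fin n) : extendAngles θ i = θ i := by
  simp [extendAngles]

lemma extendAngles_self {n : ℕ} (θ : Fin n → ℝ) : extendAngles θ n = 2 * Real.pi := by
  simp [extendAngles]

lemma angles_zero {n : ℕ} {θ : Fin (n + 1) → ℝ} (hθ : StrictMono θ)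
    (hmem : ∀ i, θ i ∈ Set.Ico 0 (2 * Real.pi)) (h0 : 0 ∈ Set.range θ) : θ 0 = 0 := by
  obtain ⟨i, hi⟩ := h0
  exact le_antisymm (hi ▸ hθ.monotone (Fin.zero_le i)) (hmem 0).1

lemma exists_axisPartition_extendAngles {n : ℕ} {θ : Fin (n + 1) → ℝ} (hθ : StrictMono θ)
    (hmem : ∀ i, θ i ∈ Set.Ico 0 (2 * Real.pi)) (h0 : 0 ∈ Set.range θ)
    (h1 : Real.pi / 2 ∈ Set.range θ) (h2 : Real.pi ∈ Set.range θ)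
    (h3 : 3 * Real.pi / 2 ∈ Set.range θ) :
    ∃ k₁ k₂ k₃, AxisPartition (n + 1) (extendAngles θ) k₁ k₂ k₃ := by
  have hz := angles_zero hθ hmem h0
  obtain ⟨i1, h1⟩ := h1
  obtain ⟨i2, h2⟩ := h2
  obtain ⟨i3, h3⟩ := h3
  have hpi := Real.pi_pos
  refine ⟨i1, i2, i3, ?_, ?_, ?_, i3.2.le, ?_, ?_, ?_, ?_, extendAngles_self θ⟩
  · intro i j hij hj
    have hi : i < n + 1 := by omega
    rcases hj.lt_or_eq with hj | rfl
    · simp only [extendAngles, hi, hj, dif_pos]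
      exact hθ hij
    · rw [extendAngles_self]
      simp only [extendAngles, hi, dif_pos]
      exact (hmem _).2
  · exact (hθ.le_iff_le.1 (by rw [h1, h2]; linarith) : i1 ≤ i2)
  · exact (hθ.le_iff_le.1 (by rw [h2, h3]; linarith) : i2 ≤ i3)
  · rw [← hz]; exact extendAngles_val θ 0
  · rw [extendAngles_val, h1]
  · rw [extendAngles_val, h2]
  · rw [extendAngles_val, h3]

lemma tan_extendAngles_le_iSup {n : ℕ} {θ : Fin (n + 1) → ℝ} (hz : θ 0 = 0) {j : ℕ}
    (hj : j < n + 1) : Real.tan ((extendAngles θ (j + 1) - extendAngles θ j) / 2) ≤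
      ⨆ i : Fin (n + 1), Real.tan ((θ (finRotate (n + 1) i) - θ i) / 2) := by
  refine le_trans (le_of_eq ?_) (le_ciSup (f := fun i : Fin (n + 1) =>
    Real.tan ((θ (finRotate (n + 1) i) - θ i) / 2)) (Set.finite_range _).bddAbove ⟨j, hj⟩)
  have e : extendAngles θ j = θ ⟨j, hj⟩ := extendAngles_val θ ⟨j, hj⟩
  rcases Nat.lt_or_ge j n with h | h
  · simp only [finRotate_of_lt h]
    rw [e, ← extendAngles_val θ ⟨j + 1, _⟩]
  · obtain rfl : j = n := by omega
    -- At the last index the cyclic difference is `0 - θ_n` instead of `2π - θ_n`; the half-angles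
    -- differ by `π`, a period of `tan`.
    have hlast : (⟨j, hj⟩ : Fin (j + 1)) = Fin.last j := rfl
    simp only [hlast, finRotate_last, hz]
    rw [e, hlast, extendAngles_self, ← Real.tan_add_pi ((0 - θ (Fin.last j)) / 2)]
    congr 1
    ring

/-- Every convex body in the unit square has a circumscribed polygon in the class, with controlled
Nikodym distance. -/
lemma exists_polygonClass_nikodymDist_le {K : Set Plane} (hK : IsCompact K) (hconv : Convex ℝ K)
    (hne : K.Nonempty) (hKsq : K ⊆ unitSquare) {n : ℕ} {θ : Fin n → ℝ} (hθ : StrictMono θ)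
    (hmem : ∀ i, θ i ∈ Set.Ico 0 (2 * Real.pi)) (h0 : 0 ∈ Set.range θ)
    (h1 : Real.pi / 2 ∈ Set.range θ) (h2 : Real.pi ∈ Set.range θ)
    (h3 : 3 * Real.pi / 2 ∈ Set.range θ) :
    0 ≤ ⨆ i : Fin n, Real.tan ((θ (finRotate n i) - θ i) / 2) ∧
    ∃ Q ∈ polygonClass θ,
      nikodymDist K Q ≤ ⨆ i : Fin n, Real.tan ((θ (finRotate n i) - θ i) / 2) := by
  obtain _ | n := n
  · obtain ⟨i, -⟩ := h0
    exact i.elim0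
  have hz := angles_zero hθ hmem h0
  obtain ⟨k₁, k₂, k₃, hA⟩ := exists_axisPartition_extendAngles hθ hmem h0 h1 h2 h3
  have hM := fun j (hj : j < n + 1) => tan_extendAngles_le_iSup hz hj
  set M := ⨆ i : Fin (n + 1), Real.tan ((θ (finRotate (n + 1) i) - θ i) / 2)
  have hM0 : 0 ≤ M := by
    refine le_trans ?_ (hM 0 n.succ_pos)
    have hs := hA.sin_gap_pos n.succ_pos
    rw [tan_half_eq hs]
    exact (div_pos hs (one_add_cos_pos hs)).le
  refine ⟨hM0, ?_⟩
  -- Contact points are chosen as a function of the direction, not of the index, so the angles `0`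
  -- and `2π` share one and the contact polygon closes up.
  choose c hcK hc using exists_contact hK hne
  let p : ℕ → Plane := fun j => c (direction (extendAngles θ j))
  have hp : ∀ j, ∀ x ∈ K, inner ℝ x (direction (extendAngles θ j)) ≤
      inner ℝ (p j) (direction (extendAngles θ j)) := fun j x hx => hc _ x hx
  have hper : p (n + 1) = p 0 := by
    simp only [p, hA.last, hA.zero]
    congr 1
    simp [direction]
  have hp' : ∀ i : Fin (n + 1), ∀ x ∈ K, inner ℝ x (direction (θ i)) ≤
      inner ℝ (p i) (direction (θ i)) := fun i x hx => by
    have := hp i x hx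
    rwa [extendAngles_val] at this
  set Q := polygon θ fun i => inner ℝ (p i) (direction (θ i)) with hQdef
  have hKQ : K ⊆ Q := fun x hx i => hp' i x hx
  refine ⟨Q, ⟨polygon_subset_unitSquare (fun i => hKsq (hcK _)) h0 h1 h2 h3, _,
    consistent_of_contact hne (fun i => hcK _) hp', rfl⟩, ?_⟩
  have hdiff : K ∆ Q = Q \ K := symmDiff_of_le hKQ
  rw [nikodymDist, hdiff]
  refine volume_circumscribed_diff_le (p := p) hA hK hconv hKsq (fun j => hcK _) hper hp
    (fun x hx j hj => ?_) hM0 hM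
  rcases hj.lt_or_eq with hj | rfl
  · have hxj : inner ℝ x (direction (θ ⟨j, hj⟩)) ≤ inner ℝ (p j) (direction (θ ⟨j, hj⟩)) :=
      hx ⟨j, hj⟩
    rwa [← extendAngles_val θ ⟨j, hj⟩] at hxj
  · have hx0 : inner ℝ x (direction (θ 0)) ≤ inner ℝ (p 0) (direction (θ 0)) := hx 0
    have e : direction (extendAngles θ (n + 1)) = direction (θ 0) := by
      rw [hA.last, hz]; simp [direction]
    rwa [hper, e]

end LegendreReconstruction

/- `finRotate n` is the cyclic successor `i ↦ i + 1` on indices (the last index goes to the first),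
so that `θ (finRotate n i)` is `θ_{i+1}` with `θ_{n+1} = θ_1`. The supremum is the maximum of a
finite nonempty family: the last four hypotheses on `θ` force `n ≥ 4`. -/
theorem mainTheorem7 :
    ∃ a₁ : ℝ, 0 < a₁ ∧
      ∀ (K : ConvexBody LegendreReconstruction.Plane),
        (interior (K : Set LegendreReconstruction.Plane)).Nonempty →
        (K : Set LegendreReconstruction.Plane) ⊆ LegendreReconstruction.unitSquare →
      ∀ (n : ℕ) (θ : Fin n → ℝ),
        StrictMono θ →
        (∀ i, θ i ∈ Set.Ico 0 (2 * Real.pi)) →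
        0 ∈ Set.range θ →
        Real.pi / 2 ∈ Set.range θ →
        Real.pi ∈ Set.range θ →
        3 * Real.pi / 2 ∈ Set.range θ →
      ∀ (N : ℕ) (P : Set LegendreReconstruction.Plane),
        LegendreReconstruction.IsLeastSquaresEstimator θ N K P →
        LegendreReconstruction.nikodymDist P K ≤
          Real.sqrt 2 * (⨆ i : Fin n, Real.tan ((θ (finRotate n i) - θ i) / 2))
            + a₁ / ((N : ℝ) + 1) := by
  open LegendreReconstruction in
  refine ⟨64, by norm_num, ?_⟩
  intro K hint hKsq n θ hθ hmem h0 h1 h2 h3 N P hP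
  obtain ⟨hPmem, hPmin⟩ := hP
  obtain ⟨hPc, hPconv⟩ := polygonClass_isCompact_convex hPmem
  have hne := hint.mono interior_subset
  obtain ⟨hM0, Q, hQ, hKQ⟩ := exists_polygonClass_nikodymDist_le K.isCompact K.convex hne hKsq
    hθ hmem h0 h1 h2 h3
  obtain ⟨hQc, -⟩ := polygonClass_isCompact_convex hQ
  have hcomm : nikodymDist P K = nikodymDist K P := by
    rw [nikodymDist, nikodymDist, symmDiff_comm]
  have s1 := nikodymDist_le_momentError_add K.isCompact K.convex hKsq hPc hPconv hPmem.1 N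
  have s2 : momentError N K P ≤ momentError N K Q := hPmin hQ
  have s3 := momentError_le_nikodymDist K.isCompact.measurableSet hKsq hQc.measurableSet hQ.1 N
  have s4 : 1 ≤ Real.sqrt 2 := Real.one_le_sqrt.2 (by norm_num)
  -- The estimate holds with factor `1`; nonnegativity of the maximum allows weakening it to `√2`.
  have s5 := le_mul_of_one_le_left hM0 s4
  rw [hcomm]
  linarith
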